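/- **Setting.** Let $K$ be a field of characteristic $0$, $\mathfrak g$ a finite-dimensional simple Lie algebra over $K$ with a splitting Cartan subalgebra $\mathfrak h$, root system $\Phi\subset\mathfrak h^*$ and a base $\{\alpha_i\}$ of simple roots. Let $H_\alpha\in\mathfrak h$ be the coroot of $\alpha$, $H_i=H_{\alpha_i}$, and let $X_\alpha$ ($\alpha\in\Phi$) be root vectors with $[X_\alpha,X_{-\alpha}]=H_\alpha$; write $X_{-i}=X_{-\alpha_i}$. Let $(\ ,\ )$ be a Weyl-invariant symmetric bilinear form on $\mathfrak h^*$ with $(\alpha,\alpha)\neq0$ for all roots $\alpha$, and put $d_\alpha=(\alpha,\alpha)/2$, $d_i=d_{\alpha_i}$. Let $a_{ij}=\alpha_j(H_i)$ be the Cartan matrix, $A_{ij}=d_i(a^{-1})_{ij}$, and give $\mathfrak g$ the Drinfeld–Sklyanin cobracket $\delta\xi=\mathrm{ad}_\xi(r)$, where $$r=\sum_{\alpha>0}d_\alpha X_\alpha\otimes X_{-\alpha}+\tfrac12\sum_{i,j}A_{ij}H_i\otimes H_j .$$ A Lie bialgebra is a Lie algebra with an antisymmetric $\delta$ that satisfies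 the coJacobi identity and $\delta[x,y]=\mathrm{ad}_x\delta y-\mathrm{ad}_y\delta x$. For a Lie bialgebra $\mathfrak f$, a crossed $\mathfrak f$-module is an $\mathfrak f$-module $V$ with a linear map $\beta:V\to\mathfrak f\otimes V$, $\beta(v)=v^{1}\otimes v^{2}$, such that $(\delta\otimes\mathrm{id})\beta=((\mathrm{id}-\tau)\otimes\mathrm{id})(\mathrm{id}\otimes\beta)\beta$ and $\beta(\xi\triangleright v)=([\xi,\,]\otimes\mathrm{id}+\mathrm{id}\otimes\xi\triangleright)\beta(v)+\xi_{(1)}\otimes\xi_{(2)}\triangleright v$, where $\tau$ is the flip and $\delta\xi=\xi_{(1)}\otimes\xi_{(2)}$; its infinitesimal braiding is $$\psi(v\otimes w)=w^{1}\triangleright v\otimes w^{2}-v^{1}\triangleright w\otimes v^{2}-w^{2}\otimes w^{1}\triangleright v+v^{2}\otimes v^{1}\triangleright w .$$ A braided-Lie bialgebra in the category of crossed $\mathfrak f$-modules is a crossed $\mathfrak f$-module $\mathfrak b$ with a Lie bracket and a Lie cobracket $\underline\delta$ (antisymmetric, coJacobi), both covariant under the action and under the coaction of $\mathfrak f$,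 such that $\underline\delta[x,y]=\mathrm{ad}_x\underline\delta y-\mathrm{ad}_y\underline\delta x-\psi(x\otimes y)$. **Proposition 4.5.** Let $i_0$ be a simple root whose deletion again generates the root system of a simple Lie algebra, that is, the Lie subalgebra of $\mathfrak g$ generated by the root spaces $\mathfrak g_{\pm\alpha_j}$, $j\ne i_0$, is simple. A positive root $\alpha=\sum_i n_i\alpha_i$ is said to contain $\alpha_{i_0}$ if $n_{i_0}\neq0$. Let $\mathfrak b_-\subset\mathfrak g$ be the negative Borel subalgebra (generated by $\mathfrak h$ and all $X_{-\alpha}$, $\alpha>0$) and $\mathfrak f\subset\mathfrak b_-$ the subalgebra generated by $\mathfrak h$ and the $X_{-\alpha}$ such that $\alpha>0$ does not contain $\alpha_{i_0}$. Then: 1. $(\mathfrak g,\delta)$ is a Lie bialgebra, and $\mathfrak b_-$ and $\mathfrak f$ are sub-Lie bialgebras of it. 2. There is a linear map $\pi:\mathfrak b_-\to\mathfrak f$ with $\pi(h)=h$ for $h\in\mathfrak h$, $\pi(X_{-\alpha})=0$ if $\alpha>0$ contains $\alpha_{i_0}$, and $\pi(X_{-\alpha})=X_{-\alpha}$ if $\alpha>0$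 does not contain it; it is a homomorphism of Lie bialgebras, and $\pi\circ i=\mathrm{id}$ for the inclusion $i:\mathfrak f\hookrightarrow\mathfrak b_-$ (a split Lie bialgebra projection). 3. $\mathfrak b=\ker\pi$ is the Lie ideal of $\mathfrak b_-$ generated by $X_{-i_0}$, and it is a braided-Lie bialgebra in the category of crossed $\mathfrak f$-modules, with the bracket of $\mathfrak b_-$ and $$\xi\triangleright x=[\xi,x],\qquad \beta=(\pi\otimes\mathrm{id})\circ\delta,\qquad \underline\delta=(\mathrm{id}-i\circ\pi)^{\otimes2}\circ\delta .$$ -/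

import Mathlib

open scoped TensorProduct

noncomputable section

namespace LieBialg

/-! ### Lie coalgebras, Lie bialgebras and their maps -/

section General

variable {K : Type*} [Field K]

/-- The flip `τ : v ⊗ w ↦ w ⊗ v` of `V ⊗ V`. -/
abbrev flip (K V : Type*) [Field K] [AddCommGroup V] [Module K V] :
    V ⊗[K] V →ₗ[K] V ⊗[K] V :=
  (TensorProduct.comm K V V).toLinearMap

/-- The cyclic permutation `x ⊗ y ⊗ z ↦ y ⊗ z ⊗ x` of `V ⊗ V ⊗ V`. -/
def cyc (K V : Type*) [Field K] [AddCommGroup V] [Module K V] :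
    V ⊗[K] (V ⊗[K] V) →ₗ[K] V ⊗[K] (V ⊗[K] V) :=
  (TensorProduct.assoc K V V V).toLinearMap ∘ₗ (TensorProduct.comm K V (V ⊗[K] V)).toLinearMap

/-- `(V, δ)` is a Lie coalgebra: `δ` is antisymmetric and satisfies the coJacobi identity.
(All fields in use have characteristic zero, so that antisymmetric is the same as alternating.) -/
structure IsLieCoalgebra {V : Type*} [AddCommGroup V] [Module K V]
    (δ : V →ₗ[K] V ⊗[K] V) : Prop where
  antisymm : ∀ x, flip K V (δ x) = -δ x
  coJacobi : ∀ x, δ.lTensor V (δ x) + cyc K V (δ.lTensor V (δ x))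
    + cyc K V (cyc K V (δ.lTensor V (δ x))) = 0

/-- `(L, δ)` is a Lie bialgebra: `δ` is a Lie cobracket and a 1-cocycle with values in `L ⊗ L`. The
bracket `⁅x, t⁆` of `x : L` with `t : L ⊗ L` is the natural extension of the adjoint action. -/
structure IsLieBialgebra {L : Type*} [LieRing L] [LieAlgebra K L]
    (δ : L →ₗ[K] L ⊗[K] L) : Prop extends IsLieCoalgebra δ where
  cocycle : ∀ x y, δ ⁅x, y⁆ = ⁅x, δ y⁆ - ⁅y, δ x⁆

/-- A homomorphism of Lie algebras which is also a map of Lie coalgebras. -/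
def IsLieBialgebraMap {L M : Type*} [LieRing L] [LieAlgebra K L] [LieRing M] [LieAlgebra K M]
    (δL : L →ₗ[K] L ⊗[K] L) (δM : M →ₗ[K] M ⊗[K] M) (φ : L →ₗ⁅K⁆ M) : Prop :=
  ∀ x, TensorProduct.map (φ : L →ₗ[K] M) (φ : L →ₗ[K] M) (δL x) = δM (φ x)

/-- A Lie subalgebra `s` of the Lie bialgebra `(L, δ)`, equipped with the cobracket `δs`, is a
sub-Lie bialgebra: `(s, δs)` is a Lie bialgebra and `δs` is the restriction of `δ`. -/
structure IsSubLieBialgebra {L : Type*} [LieRing L] [LieAlgebra K L]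
    (δ : L →ₗ[K] L ⊗[K] L) (s : LieSubalgebra K L) (δs : s →ₗ[K] s ⊗[K] s) : Prop where
  isLieBialgebra : IsLieBialgebra δs
  isLieBialgebraMap : IsLieBialgebraMap δs δ s.incl

/-- A split projection `π : G → F` of Lie bialgebras, split by `i : F → G`. -/
structure IsSplitLieBialgebraProjection {G F : Type*} [LieRing G] [LieAlgebra K G]
    [LieRing F] [LieAlgebra K F] (δG : G →ₗ[K] G ⊗[K] G) (δF : F →ₗ[K] F ⊗[K] F)
    (π : G →ₗ⁅K⁆ F) (i : F →ₗ⁅K⁆ G) : Prop where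
  isLieBialgebra_source : IsLieBialgebra δG
  isLieBialgebra_target : IsLieBialgebra δF
  isLieBialgebraMap_proj : IsLieBialgebraMap δG δF π
  isLieBialgebraMap_incl : IsLieBialgebraMap δF δG i
  proj_incl : ∀ ξ, π (i ξ) = ξ

/-! ### Crossed modules and braided-Lie bialgebras -/

section Crossed

variable {F : Type*} [LieRing F] [LieAlgebra K F]

/-- The map `F ⊗ V → V`, `ξ ⊗ v ↦ ξ ▷ v`, of an action of `F` on `V`. -/
def actMap {V : Type*} [AddCommGroup V] [Module K V] (act : F →ₗ[K] Module.End K V) :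
    F ⊗[K] V →ₗ[K] V :=
  TensorProduct.lift act

/-- The diagonal (derivation-like) action of `ξ` on `V ⊗ W`, where `ξ` acts on `V` by `a` and on
`W` by `c`. -/
def diagAct {V W : Type*} [AddCommGroup V] [Module K V] [AddCommGroup W] [Module K W]
    (a : Module.End K V) (c : Module.End K W) : Module.End K (V ⊗[K] W) :=
  a.rTensor W + c.lTensor V

/-- `V` with the action `act` and the coaction `β` is a crossed module over the Lie bialgebra
`(F, δ)`. -/
structure IsCrossedModule {V : Type*} [AddCommGroup V] [Module K V] (δ : F →ₗ[K] F ⊗[K] F)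
    (act : F →ₗ[K] Module.End K V) (β : V →ₗ[K] F ⊗[K] V) : Prop where
  /-- `act` is an action of the Lie algebra `F`. -/
  act_lie : ∀ ξ η v, act ⁅ξ, η⁆ v = act ξ (act η v) - act η (act ξ v)
  /-- `(δ ⊗ id) ∘ β = ((id - τ) ⊗ id) ∘ (id ⊗ β) ∘ β`. -/
  coaction : ∀ v, δ.rTensor V (β v) =
    (LinearMap.id - flip K F).rTensor V
      ((TensorProduct.assoc K F F V).symm (β.lTensor F (β v)))
  /-- `β(ξ ▷ v) = ([ξ, ·] ⊗ id + id ⊗ ξ ▷) β(v) + (δ ξ) ▷ v`, where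
  `(δ ξ) ▷ v = ξ₁ ⊗ ξ₂ ▷ v`. -/
  compat : ∀ ξ v, β (act ξ v) =
    diagAct (LieAlgebra.ad K F ξ) (act ξ) (β v)
      + ((actMap act).lTensor F) (TensorProduct.assoc K F F V (δ ξ ⊗ₜ[K] v))

/-- The linear map `u ↦ (u₁ ▷ v) ⊗ u₂`, for `u = u₁ ⊗ u₂` in `F ⊗ V`. -/
def actLeft {V : Type*} [AddCommGroup V] [Module K V] (act : F →ₗ[K] Module.End K V) (v : V) :
    F ⊗[K] V →ₗ[K] V ⊗[K] V :=
  (act.flip v).rTensor V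

/-- The infinitesimal braiding of a crossed module,
`ψ(v ⊗ w) = w¹ ▷ v ⊗ w² - v¹ ▷ w ⊗ v² - w² ⊗ w¹ ▷ v + v² ⊗ v¹ ▷ w`, where `β v = v¹ ⊗ v²`. -/
def infBraiding {V : Type*} [AddCommGroup V] [Module K V] (act : F →ₗ[K] Module.End K V)
    (β : V →ₗ[K] F ⊗[K] V) (v w : V) : V ⊗[K] V :=
  actLeft act v (β w) - actLeft act w (β v)
    - flip K V (actLeft act v (β w)) + flip K V (actLeft act w (β v))

/-- A braided-Lie bialgebra in the category of crossed modules over the Lie bialgebra `(F, δF)`: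
a Lie algebra `B` with an action `act` of `F`, a coaction `β` of `F` and a Lie cobracket `δB`. -/
structure IsBraidedLieBialgebra {B : Type*} [LieRing B] [LieAlgebra K B]
    (δF : F →ₗ[K] F ⊗[K] F) (act : F →ₗ[K] Module.End K B) (β : B →ₗ[K] F ⊗[K] B)
    (δB : B →ₗ[K] B ⊗[K] B) : Prop extends IsCrossedModule δF act β, IsLieCoalgebra δB where
  /-- The bracket is covariant under the action. -/
  bracket_act : ∀ ξ x y, act ξ ⁅x, y⁆ = ⁅act ξ x, y⁆ + ⁅x, act ξ y⁆
  /-- The bracket is covariant under the coaction: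
  `β [x, y] = y¹ ⊗ [x, y²] - x¹ ⊗ [y, x²]`. -/
  bracket_coact : ∀ x y, β ⁅x, y⁆ =
    (LieAlgebra.ad K B x).lTensor F (β y) - (LieAlgebra.ad K B y).lTensor F (β x)
  /-- The cobracket is covariant under the action. -/
  cobracket_act : ∀ ξ x, δB (act ξ x) = diagAct (act ξ) (act ξ) (δB x)
  /-- The cobracket is covariant under the coaction:
  `(id ⊗ δB) ∘ β = (id ⊗ (id - τ)) ∘ (β ⊗ id) ∘ δB`. -/
  cobracket_coact : ∀ x, δB.lTensor F (β x) =
    (LinearMap.id - flip K B).lTensor F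
      (TensorProduct.assoc K F B B (β.rTensor B (δB x)))
  /-- The braided cocycle condition. -/
  braided_cocycle : ∀ x y, δB ⁅x, y⁆ = ⁅x, δB y⁆ - ⁅y, δB x⁆ - infBraiding act β x y

end Crossed

end General

/-! ### The Drinfeld-Sklyanin Lie bialgebra of a split simple Lie algebra -/

section DrinfeldSklyanin

open LieAlgebra LieAlgebra.IsKilling LieModule

variable {K L : Type*} [Field K] [CharZero K] [LieRing L] [LieAlgebra K L]
  [FiniteDimensional K L] [IsKilling K L] {H : LieSubalgebra K L} [H.IsCartanSubalgebra]
  [IsTriangularizable K H L]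

/-- `X` is the system of root vectors of a Cartan-Weyl basis: for every root `α`, `X α` is a root
vector of weight `α`, and `[X α, X (-α)] = H_α` is the coroot. (The value of `X` at the zero
weight plays no role.) -/
structure IsCartanWeyl (X : Weight K H L → L) : Prop where
  mem : ∀ α : Weight K H L, α.IsNonZero → X α ∈ rootSpace H α
  lie : ∀ α : Weight K H L, α.IsNonZero → ⁅X α, X (-α)⁆ = (coroot α : L)

variable (b : (rootSystem H).Base) (B : (rootSystem H).InvariantForm)

/-- The root `α` contains the simple root `α_{i₀}`: the coefficient `n_{i₀}` in
`α = ∑ i, n_i α_i` is not zero. -/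
def Contains (i₀ : b.support) (α : H.root) : Prop :=
  b.toWeightBasis.repr ((rootSystem H).root α) i₀ ≠ 0

/-- The length `d_α = (α, α) / 2`. -/
def len (α : H.root) : K :=
  B.form ((rootSystem H).root α) ((rootSystem H).root α) / 2

/-- The Cartan matrix `a i j = α_j(H_i)`, with entries in `K`. -/
def cartanMat : Matrix b.support b.support K :=
  Matrix.of fun i j => (rootSystem H).pairing j i

open Classical in
/-- `A i j = d_i (a⁻¹) i j`. -/
def cartanCoeff (i j : b.support) : K :=
  len B i * (cartanMat b)⁻¹ i j

open Classical in
/-- The Drinfeld-Sklyanin element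
`r = ∑_{α > 0} d_α X_α ⊗ X_{-α} + (1/2) ∑_{i, j} A_{i j} H_i ⊗ H_j`. -/
def rMatrix (X : Weight K H L → L) : L ⊗[K] L :=
  (∑ α : H.root with b.IsPos α, len B α • (X α ⊗ₜ[K] X (-α)))
    + (2⁻¹ : K) • ∑ i : b.support, ∑ j : b.support, cartanCoeff b B i j •
      ((coroot (i : H.root).1 : L) ⊗ₜ[K] (coroot (j : H.root).1 : L))

/-- The Drinfeld-Sklyanin cobracket `δ ξ = ad_ξ r`. -/
def cobracket (X : Weight K H L → L) : L →ₗ[K] L ⊗[K] L :=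
  (toEnd K L (L ⊗[K] L) : L →ₗ[K] Module.End K (L ⊗[K] L)).flip (rMatrix b B X)

/-- The Lie subalgebra of `L` generated by the root spaces of `α_j` and `-α_j`, where `α_j` runs
through the simple roots other than `α_{i₀}`. -/
def deleted (i₀ : b.support) : LieSubalgebra K L :=
  LieSubalgebra.lieSpan K L {x | ∃ j : b.support, j ≠ i₀ ∧
    (x ∈ rootSpace H (j : H.root).1 ∨ x ∈ rootSpace H (-(j : H.root).1))}

/-- The negative Borel subalgebra: it is generated by the Cartan subalgebra and the root spaces of
the negative roots. -/
def negBorel : LieSubalgebra K L :=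
  LieSubalgebra.lieSpan K L
    {x | x ∈ H ∨ ∃ α : H.root, b.IsPos α ∧ x ∈ rootSpace H (-α.1)}

/-- The subalgebra of the negative Borel subalgebra that is generated by the Cartan subalgebra and
the root spaces of the negative roots `-α` such that `α` does not contain `α_{i₀}`. -/
def subBorel (i₀ : b.support) : LieSubalgebra K L :=
  LieSubalgebra.lieSpan K L
    {x | x ∈ H ∨ ∃ α : H.root, b.IsPos α ∧ ¬ Contains b i₀ α ∧ x ∈ rootSpace H (-α.1)}

theorem subBorel_le (i₀ : b.support) : subBorel b i₀ ≤ negBorel b :=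
  LieSubalgebra.lieSpan_mono fun _ hx =>
    hx.imp id fun ⟨α, h, _, h'⟩ => ⟨α, h, h'⟩

/-- The inclusion of `subBorel` in `negBorel`. -/
def subBorelIncl (i₀ : b.support) : subBorel b i₀ →ₗ⁅K⁆ negBorel b :=
  LieSubalgebra.inclusion (subBorel_le b i₀)

end DrinfeldSklyanin

end LieBialg

end

/-! The argument works with dual Lie algebras. Products of functionals separate tensors, so `δ` is a
Lie cobracket as soon as `dualBracket δ` is a Lie bracket on the linear dual.

For `(g, δ)`: an invariant form `κ`, the Killing form rescaled to match `B`, turns `r` into the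
operator `rOp`, written R here, with eigenvalue 1 on positive root spaces, 1/2 on the Cartan
subalgebra and 0 on negative ones. Its transpose is T = 1 - R, and the dual bracket becomes x * y =
[T x, T y] - [R x, R y] (`dualBracket_cobracket`). Both -R and T carry * to the Lie bracket, which
yields the Jacobi identity for * (`star_jacobi`). The cocycle condition is automatic, since `δ` is a
coboundary.

For the Borel part: on weight vectors * is the Lie bracket times a factor that vanishes for weights
of opposite sign (`star_of_mem`). Hence `δ` preserves the negative Borel subalgebra, and it commutes
with the projection that kills the roots containing `i₀` (`weightProj_cobracket_of_isNonpos`,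
`weightProj_cobracket_of_isFree`). On the Borel subalgebra this projection also respects brackets.
Its kernel is generated by one root vector, because positive roots are built by adding simple roots
and the bracket of two root spaces is nonzero whenever the sum is a root
(`rootSpace_le_of_contains`).

The braided structure exists for every split projection G → F: the dual of G is the semidirect
product of the dual of F with the ideal of functionals vanishing on F. The axioms of a braided-Lie
bialgebra are the components of the Jacobi identities and of the cocycle condition in this
decomposition (`isBraidedLieBialgebra`). -/

noncomputable section

namespace LieBialg

/-! ### Testing tensors against functionals -/

section Pair

variable {K : Type*} [Field K] {U V W U' V' : Type*}
  [AddCommGroup U] [Module K U] [AddCommGroup V] [Module K V] [AddCommGroup W] [Module K W]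
  [AddCommGroup U'] [Module K U'] [AddCommGroup V'] [Module K V']

/-- The functional `v ⊗ w ↦ f v * g w` on `V ⊗ W`. -/
def pair (f : V →ₗ[K] K) (g : W →ₗ[K] K) : V ⊗[K] W →ₗ[K] K :=
  LinearMap.mul' K K ∘ₗ TensorProduct.map f g

@[simp] theorem pair_tmul (f : V →ₗ[K] K) (g : W →ₗ[K] K) (v : V) (w : W) :
    pair f g (v ⊗ₜ w) = f v * g w := rfl

@[simp] theorem pair_zero_left (g : W →ₗ[K] K) : pair (0 : V →ₗ[K] K) g = 0 := by
  ext; simp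

@[simp] theorem pair_zero_right (f : V →ₗ[K] K) : pair f (0 : W →ₗ[K] K) = 0 := by
  ext; simp

theorem pair_add_right (f : V →ₗ[K] K) (g g' : W →ₗ[K] K) :
    pair f (g + g') = pair f g + pair f g' := by
  ext; simp [mul_add]

theorem pair_neg_right (f : V →ₗ[K] K) (g : W →ₗ[K] K) : pair f (-g) = -pair f g := by
  ext; simp

theorem pair_sub_left (f f' : V →ₗ[K] K) (g : W →ₗ[K] K) :
    pair (f - f') g = pair f g - pair f' g := by
  ext; simp [sub_mul]

theorem pair_sub_right (f : V →ₗ[K] K) (g g' : W →ₗ[K] K) :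
    pair f (g - g') = pair f g - pair f g' := by
  ext; simp [mul_sub]

theorem pair_map (f : V →ₗ[K] K) (g : W →ₗ[K] K) (a : V' →ₗ[K] V) (c : U' →ₗ[K] W)
    (t : V' ⊗[K] U') : pair f g (TensorProduct.map a c t) = pair (f ∘ₗ a) (g ∘ₗ c) t := by
  induction t with
  | zero => simp
  | tmul x y => simp
  | add x y hx hy => simp [hx, hy]

theorem pair_lTensor (f : V →ₗ[K] K) (g : W →ₗ[K] K) (c : U' →ₗ[K] W) (t : V ⊗[K] U') :
    pair f g (c.lTensor V t) = pair f (g ∘ₗ c) t :=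
  pair_map f g LinearMap.id c t

theorem pair_rTensor (f : V →ₗ[K] K) (g : W →ₗ[K] K) (a : V' →ₗ[K] V) (t : V' ⊗[K] W) :
    pair f g (a.rTensor W t) = pair (f ∘ₗ a) g t :=
  pair_map f g a LinearMap.id t

theorem pair_comm (f : V →ₗ[K] K) (g : W →ₗ[K] K) (t : W ⊗[K] V) :
    pair f g (TensorProduct.comm K W V t) = pair g f t := by
  induction t with
  | zero => simp
  | tmul x y => simp [mul_comm]
  | add x y hx hy => simp [hx, hy]

theorem pair_flip (f g : V →ₗ[K] K) (t : V ⊗[K] V) : pair f g (flip K V t) = pair g f t :=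
  pair_comm f g t

theorem pair_comp_flip (f g : V →ₗ[K] K) : pair f g ∘ₗ flip K V = pair g f :=
  LinearMap.ext (pair_flip f g)

theorem pair_assoc (f : U →ₗ[K] K) (g : V →ₗ[K] K) (h : W →ₗ[K] K) (t : (U ⊗[K] V) ⊗[K] W) :
    pair f (pair g h) (TensorProduct.assoc K U V W t) = pair (pair f g) h t := by
  have : pair f (pair g h) ∘ₗ (TensorProduct.assoc K U V W).toLinearMap = pair (pair f g) h := by
    ext; simp [mul_assoc]
  exact LinearMap.congr_fun this t

theorem pair_assoc_symm (f : U →ₗ[K] K) (g : V →ₗ[K] K) (h : W →ₗ[K] K)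
    (t : U ⊗[K] (V ⊗[K] W)) :
    pair (pair f g) h ((TensorProduct.assoc K U V W).symm t) = pair f (pair g h) t := by
  rw [← pair_assoc, LinearEquiv.apply_symm_apply]

theorem pair_cyc (f g h : V →ₗ[K] K) (t : V ⊗[K] (V ⊗[K] V)) :
    pair f (pair g h) (cyc K V t) = pair h (pair f g) t := by
  simp only [cyc, LinearMap.comp_apply, LinearEquiv.coe_coe]
  rw [pair_assoc, pair_comm]

/-- In the product of a basis of `V` and a basis of `W`, every coordinate is itself a product
functional. -/
theorem pair_ext {s t : V ⊗[K] W} (h : ∀ f g, pair f g s = pair f g t) : s = t := by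
  let b := Module.Basis.ofVectorSpace K V
  let c := Module.Basis.ofVectorSpace K W
  have key (i j) (u : V ⊗[K] W) :
      (b.tensorProduct c).repr u (i, j) = pair (b.coord i) (c.coord j) u := by
    induction u with
    | zero => simp
    | tmul x y => simp [Module.Basis.tensorProduct_repr_tmul_apply, mul_comm]
    | add x y hx hy => simp [hx, hy]
  refine (b.tensorProduct c).repr.injective (Finsupp.ext fun ⟨i, j⟩ => ?_)
  rw [key, key, h]

theorem pair_ext_right {s t : U ⊗[K] (V ⊗[K] W)}
    (h : ∀ f g k, pair f (pair g k) s = pair f (pair g k) t) : s = t := by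
  -- A functional on `V ⊗ W` need not be a product, so the first factor is contracted away and
  -- `pair_ext` is used a second time.
  have contract (f : U →ₗ[K] K) (G : V ⊗[K] W →ₗ[K] K) (u : U ⊗[K] (V ⊗[K] W)) :
      pair f G u = G (TensorProduct.lid K _ (f.rTensor _ u)) := by
    have : pair f G = G ∘ₗ (TensorProduct.lid K _).toLinearMap ∘ₗ f.rTensor _ := by
      ext; simp
    exact LinearMap.congr_fun this u
  refine pair_ext fun f G => ?_
  rw [contract, contract]
  congr 1
  refine pair_ext fun g k => ?_
  rw [← contract, ← contract, h]

theorem pair_ext_left {s t : (U ⊗[K] V) ⊗[K] W}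
    (h : ∀ f g k, pair (pair f g) k s = pair (pair f g) k t) : s = t := by
  refine (TensorProduct.assoc K U V W).injective (pair_ext_right fun f g k => ?_)
  rw [pair_assoc, pair_assoc, h]

theorem pair_lie {L : Type*} [LieRing L] [LieAlgebra K L] [LieRingModule L V] [LieModule K L V]
    [LieRingModule L W] [LieModule K L W] (f : V →ₗ[K] K) (g : W →ₗ[K] K) (x : L)
    (t : V ⊗[K] W) :
    pair f g ⁅x, t⁆ = pair (f ∘ₗ LieModule.toEnd K L V x) g t
      + pair f (g ∘ₗ LieModule.toEnd K L W x) t := by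
  induction t with
  | zero => simp
  | tmul v w => simp [TensorProduct.LieModule.lie_tmul_right]
  | add s t hs ht => simp only [lie_add, map_add, hs, ht]; ring

end Pair

/-! ### The bracket on the dual of a Lie coalgebra -/

section DualBracket

variable {K : Type*} [Field K] {V W : Type*} [AddCommGroup V] [Module K V]
  [AddCommGroup W] [Module K W]

/-- The bracket of functionals that is dual to the cobracket `δ`. -/
def dualBracket (δ : V →ₗ[K] V ⊗[K] V) (f g : V →ₗ[K] K) : V →ₗ[K] K := pair f g ∘ₗ δ

theorem dualBracket_apply (δ : V →ₗ[K] V ⊗[K] V) (f g : V →ₗ[K] K) (x : V) :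
    dualBracket δ f g x = pair f g (δ x) := rfl

theorem IsLieCoalgebra.dualBracket_antisymm {δ : V →ₗ[K] V ⊗[K] V} (h : IsLieCoalgebra δ)
    (f g : V →ₗ[K] K) : dualBracket δ f g = -dualBracket δ g f := by
  ext x
  rw [LinearMap.neg_apply, dualBracket_apply, dualBracket_apply, ← pair_flip, h.antisymm, map_neg]

theorem pair_cobracket_sq (δ : V →ₗ[K] V ⊗[K] V) (f g h : V →ₗ[K] K) (x : V) :
    pair f (pair g h) (δ.lTensor V (δ x)) = dualBracket δ f (dualBracket δ g h) x := by
  rw [pair_lTensor]; rfl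

theorem IsLieCoalgebra.dualBracket_jacobi {δ : V →ₗ[K] V ⊗[K] V} (hδ : IsLieCoalgebra δ)
    (f g h : V →ₗ[K] K) (x : V) :
    dualBracket δ f (dualBracket δ g h) x + dualBracket δ h (dualBracket δ f g) x
      + dualBracket δ g (dualBracket δ h f) x = 0 := by
  have := congrArg (pair f (pair g h)) (hδ.coJacobi x)
  simpa only [map_add, pair_cyc, pair_cobracket_sq, map_zero] using this

theorem IsLieCoalgebra.of_dualBracket {δ : V →ₗ[K] V ⊗[K] V}
    (h₁ : ∀ f g x, dualBracket δ f g x = -dualBracket δ g f x)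
    (h₂ : ∀ f g h x, dualBracket δ f (dualBracket δ g h) x
      + dualBracket δ h (dualBracket δ f g) x + dualBracket δ g (dualBracket δ h f) x = 0) :
    IsLieCoalgebra δ where
  antisymm x := pair_ext fun f g => by
    rw [pair_flip, map_neg]; exact h₁ g f x
  coJacobi x := pair_ext_right fun f g h => by
    simpa only [map_add, pair_cyc, pair_cobracket_sq, map_zero] using h₂ f g h x

theorem dualBracket_comp {δV : V →ₗ[K] V ⊗[K] V} {δW : W →ₗ[K] W ⊗[K] W} {φ : V →ₗ[K] W}
    (hφ : ∀ x, TensorProduct.map φ φ (δV x) = δW (φ x)) (f g : W →ₗ[K] K) :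
    dualBracket δV (f ∘ₗ φ) (g ∘ₗ φ) = dualBracket δW f g ∘ₗ φ := by
  ext x
  rw [dualBracket_apply, ← pair_map, hφ]; rfl

/-! ### Transfer along injective maps and restriction to subalgebras -/

theorem exists_comp_eq {φ : V →ₗ[K] W} (hφ : Function.Injective φ) (f : V →ₗ[K] K) :
    ∃ f' : W →ₗ[K] K, f' ∘ₗ φ = f := by
  obtain ⟨ρ, hρ⟩ := φ.exists_leftInverse_of_injective (LinearMap.ker_eq_bot.2 hφ)
  exact ⟨f ∘ₗ ρ, by rw [LinearMap.comp_assoc, hρ, LinearMap.comp_id]⟩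

/-- Every functional on `V` extends to `W`, and composition with `φ` respects the dual brackets, so
the identities on the dual of `W` pass to the dual of `V`. -/
theorem IsLieCoalgebra.of_injective {δV : V →ₗ[K] V ⊗[K] V} {δW : W →ₗ[K] W ⊗[K] W}
    (hW : IsLieCoalgebra δW) {φ : V →ₗ[K] W} (hinj : Function.Injective φ)
    (hφ : ∀ x, TensorProduct.map φ φ (δV x) = δW (φ x)) : IsLieCoalgebra δV := by
  refine .of_dualBracket (fun f g x => ?_) fun f g h x => ?_ <;>
  obtain ⟨f, rfl⟩ := exists_comp_eq hinj f <;> obtain ⟨g, rfl⟩ := exists_comp_eq hinj g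
  · simp only [dualBracket_comp hφ, LinearMap.comp_apply]
    rw [hW.dualBracket_antisymm]; rfl
  · obtain ⟨h, rfl⟩ := exists_comp_eq hinj h
    simp only [dualBracket_comp hφ, LinearMap.comp_apply]
    exact hW.dualBracket_jacobi f g h (φ x)

theorem map_lie {L M : Type*} [LieRing L] [LieAlgebra K L] [LieRing M] [LieAlgebra K M]
    (φ : L →ₗ⁅K⁆ M) (x : L) (t : L ⊗[K] L) :
    TensorProduct.map (φ : L →ₗ[K] M) (φ : L →ₗ[K] M) ⁅x, t⁆ =
      ⁅φ x, TensorProduct.map (φ : L →ₗ[K] M) (φ : L →ₗ[K] M) t⁆ := by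
  induction t with
  | zero => simp
  | tmul v w => simp [TensorProduct.LieModule.lie_tmul_right]
  | add s t hs ht => simp only [lie_add, map_add, hs, ht]

theorem map_injective {φ : V →ₗ[K] W} (hφ : Function.Injective φ) :
    Function.Injective (TensorProduct.map φ φ) :=
  fun s t hst => pair_ext fun f g => by
    obtain ⟨f, rfl⟩ := exists_comp_eq hφ f
    obtain ⟨g, rfl⟩ := exists_comp_eq hφ g
    rw [← pair_map, ← pair_map, hst]

theorem IsLieBialgebra.of_injective {L M : Type*} [LieRing L] [LieAlgebra K L] [LieRing M]
    [LieAlgebra K M] {δL : L →ₗ[K] L ⊗[K] L} {δM : M →ₗ[K] M ⊗[K] M} (hM : IsLieBialgebra δM)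
    {φ : L →ₗ⁅K⁆ M} (hinj : Function.Injective φ) (hφ : IsLieBialgebraMap δL δM φ) :
    IsLieBialgebra δL where
  toIsLieCoalgebra := hM.toIsLieCoalgebra.of_injective (φ := (φ : L →ₗ[K] M)) hinj hφ
  cocycle x y := map_injective (φ := (φ : L →ₗ[K] M)) hinj <| by
    rw [map_sub, map_lie, map_lie, hφ, hφ, hφ, LieHom.map_lie, hM.cocycle]

/-- The restriction of a cobracket to a subalgebra, by means of a linear projection. -/
def restrictCobracket {L : Type*} [LieRing L] [LieAlgebra K L] (δ : L →ₗ[K] L ⊗[K] L)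
    (s : LieSubalgebra K L) (P : L →ₗ[K] s) : s →ₗ[K] s ⊗[K] s :=
  TensorProduct.map P P ∘ₗ δ ∘ₗ s.toSubmodule.subtype

/-- The hypothesis `hP` expresses that `δ` maps `s` into `s ⊗ s` without treating `s ⊗ s` as a
subspace of `L ⊗ L`. -/
theorem IsLieBialgebra.restrict {L : Type*} [LieRing L] [LieAlgebra K L]
    {δ : L →ₗ[K] L ⊗[K] L} (hδ : IsLieBialgebra δ) {s : LieSubalgebra K L} {P : L →ₗ[K] s}
    (hP : ∀ x ∈ s, TensorProduct.map (s.toSubmodule.subtype ∘ₗ P) (s.toSubmodule.subtype ∘ₗ P)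
      (δ x) = δ x) :
    IsSubLieBialgebra δ s (restrictCobracket δ s P) := by
  have key : IsLieBialgebraMap (restrictCobracket δ s P) δ s.incl := fun x => by
    refine Eq.trans ?_ (hP x x.2)
    rw [TensorProduct.map_comp]; rfl
  exact ⟨hδ.of_injective Subtype.val_injective key, key⟩

end DualBracket

/-! ### The kernel of a split projection of Lie bialgebras -/

section SplitProjection

variable {K : Type*} [Field K] {G F : Type*} [LieRing G] [LieAlgebra K G]
  [LieRing F] [LieAlgebra K F]

theorem pair_actMap {V : Type*} [AddCommGroup V] [Module K V] (act : F →ₗ[K] Module.End K V)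
    (f : F →ₗ[K] K) (g : V →ₗ[K] K) (v : V) (t : F ⊗[K] F) :
    pair f g ((actMap act).lTensor F (TensorProduct.assoc K F F V (t ⊗ₜ[K] v))) =
      pair f (g ∘ₗ act.flip v) t := by
  induction t with
  | zero => simp
  | tmul x y => simp [actMap]
  | add x y hx hy => simp only [TensorProduct.add_tmul, map_add, hx, hy]

theorem pair_diagAct {V W : Type*} [AddCommGroup V] [Module K V] [AddCommGroup W] [Module K W]
    (a : Module.End K V) (c : Module.End K W) (f : V →ₗ[K] K) (g : W →ₗ[K] K) (t : V ⊗[K] W) :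
    pair f g (diagAct a c t) = pair (f ∘ₗ a) g t + pair f (g ∘ₗ c) t := by
  rw [diagAct, LinearMap.add_apply, map_add, pair_rTensor, pair_lTensor]

theorem pair_infBraiding {V : Type*} [AddCommGroup V] [Module K V]
    (act : F →ₗ[K] Module.End K V) (β : V →ₗ[K] F ⊗[K] V) (v w : V) (f g : V →ₗ[K] K) :
    pair f g (infBraiding act β v w) =
      pair (f ∘ₗ act.flip v) g (β w) - pair (f ∘ₗ act.flip w) g (β v)
        - pair (g ∘ₗ act.flip v) f (β w) + pair (g ∘ₗ act.flip w) f (β v) := by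
  simp only [infBraiding, actLeft, map_add, map_sub, pair_flip, pair_rTensor]

/-- The four axioms that mix brackets or actions with cobrackets or coactions through the cocycle
condition (`compat`, `bracket_coact`, `cobracket_act`, `braided_cocycle`) are this identity for
vectors and functionals taken from the two summands of the splitting. -/
theorem IsLieBialgebra.dualBracket_lie {δ : G →ₗ[K] G ⊗[K] G} (hδ : IsLieBialgebra δ)
    (f g : G →ₗ[K] K) (x y : G) :
    dualBracket δ f g ⁅x, y⁆ =
      pair (f ∘ₗ LieAlgebra.ad K G x) g (δ y) + pair f (g ∘ₗ LieAlgebra.ad K G x) (δ y)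
        - (pair (f ∘ₗ LieAlgebra.ad K G y) g (δ x)
          + pair f (g ∘ₗ LieAlgebra.ad K G y) (δ x)) := by
  rw [dualBracket_apply, hδ.cocycle, map_sub, pair_lie, pair_lie]; rfl

variable {δG : G →ₗ[K] G ⊗[K] G} {δF : F →ₗ[K] F ⊗[K] F} {π : G →ₗ⁅K⁆ F} {i : F →ₗ⁅K⁆ G}

/-- The projection `id - i ∘ π` onto the kernel of a split projection `π`. -/
def kerProj (π : G →ₗ⁅K⁆ F) (i : F →ₗ⁅K⁆ G) (h : ∀ ξ, π (i ξ) = ξ) : G →ₗ[K] π.ker :=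
  LinearMap.codRestrict π.ker.toSubmodule
    (LinearMap.id - (i : F →ₗ[K] G) ∘ₗ (π : G →ₗ[K] F)) fun x => by
      change x - i (π x) ∈ π.ker
      rw [LieHom.mem_ker, map_sub, h, sub_self]

theorem coe_kerProj (h : ∀ ξ, π (i ξ) = ξ) (x : G) : (kerProj π i h x : G) = x - i (π x) := rfl

theorem kerProj_coe (h : ∀ ξ, π (i ξ) = ξ) (x : π.ker) : kerProj π i h x = x :=
  Subtype.ext <| by rw [coe_kerProj, (LieHom.mem_ker (f := π)).1 x.2, map_zero, sub_zero]

theorem kerProj_incl (h : ∀ ξ, π (i ξ) = ξ) (ξ : F) : kerProj π i h (i ξ) = 0 :=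
  Subtype.ext <| by rw [coe_kerProj, h, sub_self]; rfl

/-- The action of `F` on the kernel of a split projection. -/
def kerAct (π : G →ₗ⁅K⁆ F) (i : F →ₗ⁅K⁆ G) : F →ₗ[K] Module.End K π.ker :=
  (LieModule.toEnd K G π.ker : G →ₗ[K] Module.End K π.ker) ∘ₗ (i : F →ₗ[K] G)

theorem coe_kerAct (ξ : F) (x : π.ker) : (kerAct π i ξ x : G) = ⁅i ξ, (x : G)⁆ := rfl

/-- The coaction of `F` on the kernel of a split projection. -/
def kerCoact (δG : G →ₗ[K] G ⊗[K] G) (h : ∀ ξ, π (i ξ) = ξ) : π.ker →ₗ[K] F ⊗[K] π.ker :=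
  TensorProduct.map (π : G →ₗ[K] F) (kerProj π i h) ∘ₗ δG ∘ₗ π.ker.toSubmodule.subtype

/-- The braided cobracket on the kernel of a split projection. -/
def kerCobracket (δG : G →ₗ[K] G ⊗[K] G) (h : ∀ ξ, π (i ξ) = ξ) :
    π.ker →ₗ[K] π.ker ⊗[K] π.ker :=
  TensorProduct.map (kerProj π i h) (kerProj π i h) ∘ₗ δG ∘ₗ π.ker.toSubmodule.subtype

/-- The extension by zero of a functional on `F`. -/
def extF (π : G →ₗ⁅K⁆ F) (f : F →ₗ[K] K) : G →ₗ[K] K := f ∘ₗ (π : G →ₗ[K] F)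

/-- The extension by zero of a functional on the kernel. -/
def extK (h : ∀ ξ, π (i ξ) = ξ) (g : π.ker →ₗ[K] K) : G →ₗ[K] K := g ∘ₗ kerProj π i h

theorem pair_kerCoact (h : ∀ ξ, π (i ξ) = ξ) (f : F →ₗ[K] K) (g : π.ker →ₗ[K] K) (x : π.ker) :
    pair f g (kerCoact δG h x) = dualBracket δG (extF π f) (extK h g) x :=
  pair_map _ _ _ _ _

theorem pair_kerCobracket (h : ∀ ξ, π (i ξ) = ξ) (f g : π.ker →ₗ[K] K) (x : π.ker) :
    pair f g (kerCobracket δG h x) = dualBracket δG (extK h f) (extK h g) x :=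
  pair_map _ _ _ _ _

theorem extF_ker (f : F →ₗ[K] K) (x : π.ker) : extF π f x = 0 := by
  change f (π x) = 0
  rw [(LieHom.mem_ker (f := π)).1 x.2, map_zero]

theorem extK_incl (h : ∀ ξ, π (i ξ) = ξ) (g : π.ker →ₗ[K] K) (ξ : F) : extK h g (i ξ) = 0 := by
  change g (kerProj π i h (i ξ)) = 0
  rw [kerProj_incl, map_zero]

theorem extK_coe (h : ∀ ξ, π (i ξ) = ξ) (g : π.ker →ₗ[K] K) (x : π.ker) : extK h g x = g x :=
  congrArg g (kerProj_coe h x)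

theorem extF_incl (h : ∀ ξ, π (i ξ) = ξ) (f : F →ₗ[K] K) (ξ : F) : extF π f (i ξ) = f ξ :=
  congrArg f (h ξ)

theorem ext_splitting (h : ∀ ξ, π (i ξ) = ξ) {k k' : G →ₗ[K] K} (hF : ∀ ξ, k (i ξ) = k' (i ξ))
    (hK : ∀ x : π.ker, k x = k' x) : k = k' := by
  ext x
  have : x = (kerProj π i h x : G) + i (π x) := by rw [coe_kerProj]; abel
  rw [this, map_add, map_add, hF, hK]

namespace IsSplitLieBialgebraProjection

variable (hs : IsSplitLieBialgebraProjection δG δF π i)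

include hs

theorem dualBracket_extF_extF (f f' : F →ₗ[K] K) :
    dualBracket δG (extF π f) (extF π f') = extF π (dualBracket δF f f') :=
  dualBracket_comp hs.isLieBialgebraMap_proj f f'

theorem dualBracket_incl (k k' : G →ₗ[K] K) (ξ : F) :
    dualBracket δG k k' (i ξ) = pair (k ∘ₗ (i : F →ₗ[K] G)) (k' ∘ₗ (i : F →ₗ[K] G)) (δF ξ) :=
  (LinearMap.congr_fun (dualBracket_comp hs.isLieBialgebraMap_incl k k') ξ).symm

theorem extK_comp_incl (g : π.ker →ₗ[K] K) :
    extK hs.proj_incl g ∘ₗ (i : F →ₗ[K] G) = 0 :=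
  LinearMap.ext fun ξ => extK_incl hs.proj_incl g ξ

/-- Because `i` is a coalgebra map, the functionals that vanish on its image form an ideal of the
dual Lie algebra. The dual of `F` acts on this ideal by the transpose of the coaction. -/
theorem dualBracket_extF_extK (f : F →ₗ[K] K) (g : π.ker →ₗ[K] K) :
    dualBracket δG (extF π f) (extK hs.proj_incl g) =
      extK hs.proj_incl (pair f g ∘ₗ kerCoact δG hs.proj_incl) := by
  refine ext_splitting hs.proj_incl (fun ξ => ?_) fun x => ?_
  · rw [hs.dualBracket_incl, hs.extK_comp_incl, extK_incl]; simp
  · rw [extK_coe]; exact (pair_kerCoact _ _ _ _).symm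

theorem dualBracket_extK_extK (f g : π.ker →ₗ[K] K) :
    dualBracket δG (extK hs.proj_incl f) (extK hs.proj_incl g) =
      extK hs.proj_incl (pair f g ∘ₗ kerCobracket δG hs.proj_incl) := by
  refine ext_splitting hs.proj_incl (fun ξ => ?_) fun x => ?_
  · rw [hs.dualBracket_incl, hs.extK_comp_incl, extK_incl]; simp
  · rw [extK_coe]; exact (pair_kerCobracket _ _ _ _).symm

omit hs in
theorem extF_comp_ad_incl (h : ∀ ξ, π (i ξ) = ξ) (f : F →ₗ[K] K) (ξ : F) :
    extF π f ∘ₗ LieAlgebra.ad K G (i ξ) = extF π (f ∘ₗ LieAlgebra.ad K F ξ) := by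
  ext x
  change f (π ⁅i ξ, x⁆) = f ⁅ξ, π x⁆
  rw [LieHom.map_lie, h]

omit hs in
theorem extF_comp_ad_ker (f : F →ₗ[K] K) (v : π.ker) :
    extF π f ∘ₗ LieAlgebra.ad K G v = 0 := by
  ext x
  change f (π ⁅(v : G), x⁆) = 0
  rw [LieHom.map_lie, (LieHom.mem_ker (f := π)).1 v.2, zero_lie, map_zero]

omit hs in
theorem extK_comp_ad_incl (h : ∀ ξ, π (i ξ) = ξ) (g : π.ker →ₗ[K] K) (ξ : F) :
    extK h g ∘ₗ LieAlgebra.ad K G (i ξ) = extK h (g ∘ₗ kerAct π i ξ) := by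
  refine ext_splitting h (fun η => ?_) fun x => ?_
  · change extK h g ⁅i ξ, i η⁆ = _
    rw [← LieHom.map_lie, extK_incl, extK_incl]
  · rw [extK_coe]
    exact extK_coe h g (kerAct π i ξ x)

omit hs in
-- The bracket of `v` with `i η` is minus the action of `η` on `v`, and it stays in the kernel. The
-- resulting `extF` term is the source of the infinitesimal braiding.
theorem extK_comp_ad_ker (h : ∀ ξ, π (i ξ) = ξ) (g : π.ker →ₗ[K] K) (v : π.ker) :
    extK h g ∘ₗ LieAlgebra.ad K G v =
      extK h (g ∘ₗ LieAlgebra.ad K π.ker v) - extF π (g ∘ₗ (kerAct π i).flip v) := by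
  refine ext_splitting h (fun η => ?_) fun x => ?_
  · rw [LinearMap.sub_apply, extK_incl, extF_incl h, zero_sub]
    change extK h g ⁅(v : G), i η⁆ = -g (kerAct π i η v)
    rw [← extK_coe h g, coe_kerAct, ← lie_skew, map_neg]
  · rw [LinearMap.sub_apply, extF_ker, sub_zero, extK_coe]
    exact extK_coe h g ⁅v, x⁆

omit hs in
theorem extK_comp_ad_comp_incl (h : ∀ ξ, π (i ξ) = ξ) (g : π.ker →ₗ[K] K) (v : π.ker) :
    (extK h g ∘ₗ LieAlgebra.ad K G v) ∘ₗ (i : F →ₗ[K] G) = -(g ∘ₗ (kerAct π i).flip v) := by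
  rw [extK_comp_ad_ker h]
  ext ξ
  have h₁ := extK_incl h (g ∘ₗ LieAlgebra.ad K π.ker v) ξ
  have h₂ := extF_incl h (g ∘ₗ (kerAct π i).flip v) ξ
  simpa [h₁] using h₂

omit hs in
theorem extF_comp_incl (h : ∀ ξ, π (i ξ) = ξ) (f : F →ₗ[K] K) :
    extF π f ∘ₗ (i : F →ₗ[K] G) = f :=
  LinearMap.ext fun ξ => extF_incl h f ξ

/-- On the kernel, `(π ⊗ π) ∘ δG = δF ∘ π` vanishes. -/
theorem dualBracket_extF_extF_ker (f f' : F →ₗ[K] K) (x : π.ker) :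
    pair (extF π f) (extF π f') (δG x) = 0 := by
  rw [← dualBracket_apply, hs.dualBracket_extF_extF, extF_ker]

theorem isCrossedModule : IsCrossedModule δF (kerAct π i) (kerCoact δG hs.proj_incl) where
  act_lie ξ η v := Subtype.ext <| by
    change ⁅i ⁅ξ, η⁆, (v : G)⁆ = ⁅i ξ, ⁅i η, (v : G)⁆⁆ - ⁅i η, ⁅i ξ, (v : G)⁆⁆
    rw [LieHom.map_lie, lie_lie]
  coaction v := pair_ext_left fun f f' g => by
    rw [pair_rTensor, pair_rTensor, LinearMap.comp_sub, LinearMap.comp_id, pair_comp_flip,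
      pair_sub_left, LinearMap.sub_apply, pair_assoc_symm, pair_assoc_symm, pair_lTensor,
      pair_lTensor]
    change pair (dualBracket δF f f') g _ = _
    rw [pair_kerCoact, pair_kerCoact, pair_kerCoact, ← hs.dualBracket_extF_extF,
      ← hs.dualBracket_extF_extK, ← hs.dualBracket_extF_extK]
    have hG := hs.isLieBialgebra_source.toIsLieCoalgebra
    -- The coaction axiom is the Jacobi identity for two functionals on `F` and one on the kernel.
    have h₁ := hG.dualBracket_jacobi (extF π f) (extF π f') (extK hs.proj_incl g) v
    rw [hG.dualBracket_antisymm (extK hs.proj_incl g),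
      hG.dualBracket_antisymm (extK hs.proj_incl g) (extF π f)] at h₁
    have h₂ : dualBracket δG (extF π f') (-dualBracket δG (extF π f) (extK hs.proj_incl g)) v
        = -dualBracket δG (extF π f') (dualBracket δG (extF π f) (extK hs.proj_incl g)) v := by
      rw [dualBracket_apply, pair_neg_right]; rfl
    rw [h₂, LinearMap.neg_apply] at h₁
    linear_combination -h₁
  compat ξ v := pair_ext fun f g => by
    rw [map_add, pair_diagAct, pair_actMap, pair_kerCoact, pair_kerCoact, pair_kerCoact]
    change dualBracket δG _ _ ⁅i ξ, (v : G)⁆ = _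
    rw [hs.isLieBialgebra_source.dualBracket_lie, extF_comp_ad_incl hs.proj_incl,
      extK_comp_ad_incl, extF_comp_ad_ker, ← dualBracket_apply δG _ _ (i ξ),
      ← dualBracket_apply δG _ _ (i ξ), hs.dualBracket_incl, hs.dualBracket_incl,
      extK_comp_ad_comp_incl, extF_comp_incl hs.proj_incl, pair_neg_right]
    simp [dualBracket_apply]

theorem isLieCoalgebra_kerCobracket : IsLieCoalgebra (kerCobracket δG hs.proj_incl) := by
  have hG := hs.isLieBialgebra_source.toIsLieCoalgebra
  have key (f g : π.ker →ₗ[K] K) (x : π.ker) : dualBracket (kerCobracket δG hs.proj_incl) f g x =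
      dualBracket δG (extK hs.proj_incl f) (extK hs.proj_incl g) x := pair_kerCobracket _ _ _ _
  have key' (f g : π.ker →ₗ[K] K) : dualBracket δG (extK hs.proj_incl f) (extK hs.proj_incl g) =
      extK hs.proj_incl (dualBracket (kerCobracket δG hs.proj_incl) f g) :=
    hs.dualBracket_extK_extK f g
  refine .of_dualBracket (fun f g x => ?_) fun f g h x => ?_
  · rw [key, key, hG.dualBracket_antisymm]; rfl
  · rw [key, key, key, ← key', ← key', ← key']
    exact hG.dualBracket_jacobi _ _ _ _

/-- The kernel of a split projection of Lie bialgebras is a braided-Lie bialgebra. -/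
theorem isBraidedLieBialgebra :
    IsBraidedLieBialgebra δF (kerAct π i) (kerCoact δG hs.proj_incl)
      (kerCobracket δG hs.proj_incl) where
  toIsCrossedModule := hs.isCrossedModule
  toIsLieCoalgebra := hs.isLieCoalgebra_kerCobracket
  bracket_act ξ x y := Subtype.ext <| leibniz_lie (i ξ) (x : G) (y : G)
  bracket_coact x y := pair_ext fun f g => by
    rw [map_sub, pair_lTensor, pair_lTensor, pair_kerCoact, pair_kerCoact, pair_kerCoact]
    change dualBracket δG _ _ ⁅(x : G), (y : G)⁆ = _
    rw [hs.isLieBialgebra_source.dualBracket_lie, extF_comp_ad_ker, extF_comp_ad_ker,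
      extK_comp_ad_ker, extK_comp_ad_ker, pair_sub_right, pair_sub_right, LinearMap.sub_apply,
      LinearMap.sub_apply, hs.dualBracket_extF_extF_ker, hs.dualBracket_extF_extF_ker]
    simp [dualBracket_apply]
  cobracket_act ξ x := pair_ext fun f g => by
    rw [pair_diagAct, pair_kerCobracket, pair_kerCobracket, pair_kerCobracket]
    change dualBracket δG _ _ ⁅i ξ, (x : G)⁆ = _
    rw [hs.isLieBialgebra_source.dualBracket_lie, extK_comp_ad_incl, extK_comp_ad_incl,
      ← dualBracket_apply δG _ _ (i ξ), ← dualBracket_apply δG _ _ (i ξ), hs.dualBracket_incl,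
      hs.dualBracket_incl, hs.extK_comp_incl, hs.extK_comp_incl]
    simp [dualBracket_apply]
  cobracket_coact x := pair_ext_right fun f g h => by
    rw [pair_lTensor, pair_lTensor, LinearMap.comp_sub, LinearMap.comp_id, pair_comp_flip,
      pair_sub_right, LinearMap.sub_apply, pair_assoc, pair_assoc, pair_rTensor, pair_rTensor,
      pair_kerCoact, pair_kerCobracket, pair_kerCobracket, ← hs.dualBracket_extF_extK,
      ← hs.dualBracket_extF_extK, ← hs.dualBracket_extK_extK]
    have hG := hs.isLieBialgebra_source.toIsLieCoalgebra
    -- Covariance of the cobracket under the coaction is the Jacobi identity for one functional on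
    -- `F` and two on the kernel.
    have h₁ := hG.dualBracket_jacobi (extF π f) (extK hs.proj_incl g) (extK hs.proj_incl h) x
    rw [hG.dualBracket_antisymm (extK hs.proj_incl h),
      hG.dualBracket_antisymm (extK hs.proj_incl h) (extF π f)] at h₁
    have h₂ : dualBracket δG (extK hs.proj_incl g)
          (-dualBracket δG (extF π f) (extK hs.proj_incl h)) x
        = dualBracket δG (dualBracket δG (extF π f) (extK hs.proj_incl h))
          (extK hs.proj_incl g) x := by
      rw [hG.dualBracket_antisymm (dualBracket δG _ _), dualBracket_apply, pair_neg_right]; rfl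
    rw [h₂, LinearMap.neg_apply] at h₁
    linear_combination h₁
  braided_cocycle x y := pair_ext fun f g => by
    have hG := hs.isLieBialgebra_source.toIsLieCoalgebra
    rw [map_sub, map_sub, pair_infBraiding, pair_lie, pair_lie]
    simp only [pair_kerCoact, pair_kerCobracket]
    change dualBracket δG _ _ ⁅(x : G), (y : G)⁆ = _
    rw [hs.isLieBialgebra_source.dualBracket_lie]
    -- Each of the four adjoint terms of the cocycle condition leaves one `extF` correction.
    -- Together these corrections are the four terms of `infBraiding`.
    simp only [extK_comp_ad_ker, pair_sub_right, pair_sub_left, LinearMap.sub_apply,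
      ← dualBracket_apply]
    rw [hG.dualBracket_antisymm (extK hs.proj_incl f) (extF π _),
      hG.dualBracket_antisymm (extK hs.proj_incl f) (extF π _)]
    simp only [LinearMap.neg_apply, LieAlgebra.ad]
    ring

end IsSplitLieBialgebraProjection

/-- `kerCoact` projects the second factor to the kernel as well. Nothing is lost, since `(π ⊗ π) ∘
δG` is zero there. -/
theorem IsSplitLieBialgebraProjection.map_subtype_kerCoact
    (hs : IsSplitLieBialgebraProjection δG δF π i) (x : π.ker) :
    TensorProduct.map LinearMap.id π.ker.toSubmodule.subtype (kerCoact δG hs.proj_incl x) =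
      TensorProduct.map (π : G →ₗ[K] F) LinearMap.id (δG x) := by
  refine pair_ext fun f g => ?_
  rw [pair_map, pair_map, LinearMap.comp_id, LinearMap.comp_id, pair_kerCoact, dualBracket_apply]
  have : g = extK hs.proj_incl (g ∘ₗ π.ker.toSubmodule.subtype) +
      extF π (g ∘ₗ (i : F →ₗ[K] G)) := by
    refine ext_splitting hs.proj_incl (fun ξ => ?_) fun y => ?_
    · rw [LinearMap.add_apply, extK_incl, extF_incl hs.proj_incl, zero_add]; rfl
    · rw [LinearMap.add_apply, extF_ker, extK_coe, add_zero]; rfl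
  conv_rhs => rw [this]
  change _ = pair (extF π f) _ _
  rw [pair_add_right, LinearMap.add_apply, hs.dualBracket_extF_extF_ker, add_zero]

theorem map_subtype_kerCobracket (h : ∀ ξ, π (i ξ) = ξ) (x : π.ker) :
    TensorProduct.map π.ker.toSubmodule.subtype π.ker.toSubmodule.subtype
        (kerCobracket δG h x) =
      TensorProduct.map (LinearMap.id - (i : F →ₗ[K] G) ∘ₗ (π : G →ₗ[K] F))
        (LinearMap.id - (i : F →ₗ[K] G) ∘ₗ (π : G →ₗ[K] F)) (δG x) := by
  refine pair_ext fun f g => ?_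
  simp only [kerCobracket, LinearMap.comp_apply, pair_map]
  rfl

end SplitProjection

section Weights

open LieAlgebra LieAlgebra.IsKilling LieModule Module

variable {K L : Type*} [Field K] [CharZero K] [LieRing L] [LieAlgebra K L]
  [FiniteDimensional K L] [IsKilling K L] {H : LieSubalgebra K L} [H.IsCartanSubalgebra]
  [IsTriangularizable K H L]

/-! ### Operators that are scalar on root spaces -/

variable (K H L) in
omit [CharZero K] [IsKilling K L] in
open Classical in
theorem isInternal_rootSpace :
    DirectSum.IsInternal fun α : Weight K H L => (rootSpace H α).toSubmodule :=
  DirectSum.isInternal_submodule_of_iSupIndep_of_iSup_eq_top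
    (LieSubmodule.iSupIndep_toSubmodule.mpr <| iSupIndep_genWeightSpace' K H L)
    (LieSubmodule.iSup_toSubmodule_eq_top.mpr <| iSup_genWeightSpace_eq_top' K H L)

omit [CharZero K] [IsKilling K L] in
theorem rootSpace_induction {p : L → Prop}
    (mem : ∀ (α : Weight K H L), ∀ x ∈ rootSpace H α, p x)
    (zero : p 0) (add : ∀ x y, p x → p y → p (x + y)) (x : L) : p x := by
  have hx : x ∈ ⨆ α : Weight K H L, (rootSpace H α).toSubmodule := by
    rw [LieSubmodule.iSup_toSubmodule_eq_top.mpr <| iSup_genWeightSpace_eq_top' K H L]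
    trivial
  exact Submodule.iSup_induction _ (motive := p) hx mem zero add

open Classical in
/-- The operator that is multiplication by `c α` on the root space of `α`. -/
def weightMul (c : Weight K H L → K) : L →ₗ[K] L :=
  DirectSum.toModule K (Weight K H L) L (fun α => c α • (rootSpace H α).toSubmodule.subtype) ∘ₗ
    (LinearEquiv.ofBijective (DirectSum.coeLinearMap fun α : Weight K H L =>
      (rootSpace H α).toSubmodule) (isInternal_rootSpace K L H)).symm.toLinearMap

omit [CharZero K] [IsKilling K L] in
theorem weightMul_apply (c : Weight K H L → K) {α : Weight K H L} {x : L}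
    (hx : x ∈ rootSpace H α) : weightMul c x = c α • x := by
  classical
  have h : (LinearEquiv.ofBijective (DirectSum.coeLinearMap fun α : Weight K H L =>
      (rootSpace H α).toSubmodule) (isInternal_rootSpace K L H)).symm x =
      DirectSum.lof K (Weight K H L) (fun α => (rootSpace H α).toSubmodule) α ⟨x, hx⟩ := by
    rw [LinearEquiv.symm_apply_eq]
    exact (DirectSum.coeLinearMap_lof (R := K)
      (fun α : Weight K H L => (rootSpace H α).toSubmodule) α ⟨x, hx⟩).symm
  simp only [weightMul, LinearMap.comp_apply, LinearEquiv.coe_coe]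
  rw [h, DirectSum.toModule_lof]
  rfl

omit [CharZero K] [IsKilling K L] in
theorem weightMul_weightMul (a c : Weight K H L → K) (x : L) :
    weightMul a (weightMul c x) = weightMul (fun α => a α * c α) x := by
  induction x using rootSpace_induction (H := H) with
  | mem α x hx =>
    rw [weightMul_apply c hx, map_smul, weightMul_apply a hx, weightMul_apply _ hx, smul_smul,
      mul_comm]
  | zero => simp
  | add x y hx hy => simp only [map_add, hx, hy]

omit [CharZero K] [IsKilling K L] in
theorem weightMul_sub (a c : Weight K H L → K) (x : L) :
    weightMul (fun α => a α - c α) x = weightMul a x - weightMul c x := by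
  induction x using rootSpace_induction (H := H) with
  | mem α x hx =>
    rw [weightMul_apply c hx, weightMul_apply a hx, weightMul_apply _ hx, sub_smul]
  | zero => simp
  | add x y hx hy => simp only [map_add, hx, hy]; abel

omit [CharZero K] [IsKilling K L] in
theorem weightMul_one (x : L) : weightMul (fun _ : Weight K H L => (1 : K)) x = x := by
  induction x using rootSpace_induction (H := H) with
  | mem α x hx => rw [weightMul_apply _ hx, one_smul]
  | zero => simp
  | add x y hx hy => simp only [map_add, hx, hy]

omit [CharZero K] [IsKilling K L] in
theorem weightMul_zero (x : L) : weightMul (fun _ : Weight K H L => (0 : K)) x = 0 := by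
  induction x using rootSpace_induction (H := H) with
  | mem α x hx => rw [weightMul_apply _ hx, zero_smul]
  | zero => simp
  | add x y hx hy => simp only [map_add, hx, hy, add_zero]

omit [CharZero K] [IsKilling K L] in
theorem weightMul_mem {c : Weight K H L → K} {s : Submodule K L}
    (h : ∀ α : Weight K H L, c α ≠ 0 → (rootSpace H α).toSubmodule ≤ s) (x : L) :
    weightMul c x ∈ s := by
  induction x using rootSpace_induction (H := H) with
  | mem α x hx =>
    rw [weightMul_apply _ hx]
    by_cases hc : c α = 0
    · rw [hc, zero_smul]; exact s.zero_mem
    · exact s.smul_mem _ (h α hc hx)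
  | zero => simp
  | add x y hx hy => rw [map_add]; exact s.add_mem hx hy

omit [CharZero K] [IsKilling K L] [IsTriangularizable K H L] in
theorem mem_cartan_iff {x : L} : x ∈ H ↔ x ∈ rootSpace H (0 : H → K) := by
  rw [rootSpace_zero_eq K L H]; rfl

/-- Two vectors of weight zero commute, because `H` acts on itself by the weight zero. Setting this
case aside is what later admits the eigenvalue 1/2 on `H`. -/
theorem rootSpace_lie_mem {α β : Weight K H L} {x y : L} (hx : x ∈ rootSpace H α)
    (hy : y ∈ rootSpace H β) : ⁅x, y⁆ = 0 ∨ ((∃ γ : Weight K H L,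
      (γ : H → K) = α + β ∧ ⁅x, y⁆ ∈ rootSpace H γ) ∧ ¬ (α.IsZero ∧ β.IsZero)) := by
  by_cases h0 : ⁅x, y⁆ = 0
  · exact Or.inl h0
  have hxy := lie_mem_genWeightSpace_of_mem_genWeightSpace hx hy
  refine Or.inr ⟨⟨⟨(α : H → K) + β, fun h => h0 ?_⟩, rfl, hxy⟩, fun ⟨hα, hβ⟩ => h0 ?_⟩
  · rw [h] at hxy
    exact (LieSubmodule.mem_bot _).1 hxy
  · rw [hα.eq, ← mem_cartan_iff] at hx
    have := lie_eq_smul_of_mem_rootSpace hy ⟨x, hx⟩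
    rw [hβ.eq, Pi.zero_apply, zero_smul] at this
    exact this

/-- Compatibility of operators that are scalar on root spaces with the bracket. -/
theorem weightMul_lie {a c d e f : Weight K H L → K}
    (h : ∀ α β γ : Weight K H L, (γ : H → K) = α + β → ¬ (α.IsZero ∧ β.IsZero) →
      a γ * (c α * d β) = e α * f β) (x y : L) :
    weightMul a ⁅weightMul c x, weightMul d y⁆ = ⁅weightMul e x, weightMul f y⁆ := by
  induction x using rootSpace_induction (H := H) with
  | mem α x hx =>
    induction y using rootSpace_induction (H := H) with
    | mem β y hy =>
      rw [weightMul_apply _ hx, weightMul_apply _ hy, weightMul_apply _ hx, weightMul_apply _ hy]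
      simp only [smul_lie, lie_smul, map_smul]
      obtain h0 | ⟨⟨γ, hγ, hmem⟩, hne⟩ := rootSpace_lie_mem hx hy
      · simp [h0]
      · rw [weightMul_apply _ hmem, smul_smul, smul_smul, smul_smul]
        congr 1
        linear_combination h α β γ hγ hne
    | zero => simp
    | add y z hy hz => simp only [map_add, lie_add, hy, hz]
  | zero => simp
  | add x z hx hz => simp only [map_add, add_lie, hx, hz]

/-! ### Brackets of root spaces -/

theorem exists_smul_eq_of_mem_rootSpace {α : Weight K H L} (hα : α.IsNonZero) {x y : L}
    (hx : x ∈ rootSpace H α) (hx0 : x ≠ 0) (hy : y ∈ rootSpace H α) : ∃ c : K, c • x = y := by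
  obtain ⟨c, hc⟩ := (finrank_eq_one_iff_of_nonzero' (⟨x, hx⟩ : rootSpace H α)
    (by simpa using hx0)).mp (finrank_rootSpace_eq_one α hα) ⟨y, hy⟩
  exact ⟨c, congrArg Subtype.val hc⟩

/-- The bracket of two root spaces is not zero if the sum of the roots is a root. -/
theorem exists_lie_ne_zero {α β γ : Weight K H L} (hα : α.IsNonZero)
    (hγ : (γ : H → K) = α + β) :
    ∃ x ∈ rootSpace H α, ∃ y ∈ rootSpace H β, ⁅x, y⁆ ≠ 0 := by
  obtain ⟨x, hx, x_ne0⟩ := (chainTop α β).exists_ne_zero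
  obtain ⟨h, e, f, isSl2, he, hf⟩ := exists_isSl2Triple_of_weight_isNonZero hα
  obtain rfl := isSl2.h_eq_coroot hα he hf
  have prim : isSl2.HasPrimitiveVectorWith x (chainLength α β : K) :=
    have := lie_mem_genWeightSpace_of_mem_genWeightSpace he hx
    ⟨x_ne0, (chainLength_smul _ _ hx).symm, by rwa [genWeightSpace_add_chainTop _ _ hα] at this⟩
  have h₁ : 1 ≤ chainTopCoeff α β := by
    have := ((rootSpace_zsmul_add_ne_bot_iff α β hα 1).1
      (by rw [one_smul, ← hγ]; exact γ.genWeightSpace_ne_bot)).1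
    exact_mod_cast this
  obtain ⟨r, hr⟩ : ∃ r, chainTopCoeff α β = r + 1 := ⟨_, (Nat.sub_add_cancel h₁).symm⟩
  have h₂ : r + 1 ≤ chainLength α β := hr ▸ chainTopCoeff_le_chainLength α β
  -- Here `β + (r + 1) α` is the top of the `α`-string through `β`, so lowering a top vector `r + 1`
  -- times gives weight `β`. Applying `e` then produces the factor `(r + 1) (chainLength α β - r)`,
  -- which is nonzero because `r < chainLength α β`.
  refine ⟨e, he, ((toEnd K L L f) ^ (r + 1)) x, ?_, ?_⟩
  · have := toEnd_pow_apply_mem hf hx (r + 1)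
    rw [coe_chainTop', hr] at this
    convert this using 2
    simp
  · rw [prim.lie_e_pow_succ_toEnd_f r]
    refine smul_ne_zero (mul_ne_zero (Nat.cast_add_one_ne_zero r) ?_)
      (prim.pow_toEnd_f_ne_zero_of_eq_nat rfl (by lia))
    rw [sub_ne_zero]
    exact_mod_cast (by lia : chainLength α β ≠ r)

/-! ### Integral coefficients of weights -/

variable (b : (rootSystem H).Base)

/-- The zero weight is treated together with the roots, so that coefficients and heights are
available on the whole index set of the root space decomposition. -/
theorem exists_intCoeff (α : Weight K H L) : ∃ f : b.support → ℤ,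
    (∀ i, b.toWeightBasis.repr α.toLinear i = f i) ∧
    ((∀ i, 0 ≤ f i) ∨ (∀ i, f i ≤ 0)) ∧
    (∀ h : α ∈ H.root, ∑ i, f i = b.height ⟨α, h⟩) := by
  by_cases hα : α.IsZero
  · refine ⟨0, fun i => ?_, Or.inl fun i => le_rfl, fun h => ?_⟩
    · have : α.toLinear = 0 := by ext x; exact congrFun hα x
      rw [this]; simp
    · exact absurd hα (by simpa using h)
  · have hα' : α ∈ H.root := by simpa using hα
    obtain ⟨f, -, hf, hsum⟩ := b.exists_root_eq_sum_int ⟨α, hα'⟩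
    refine ⟨fun i => f i, fun i => ?_, ?_, fun h => ?_⟩
    · classical
      have : α.toLinear = ∑ j : b.support, f j • (rootSystem H).root j := by
        rw [Finset.sum_coe_sort b.support fun j => f j • (rootSystem H).root j, ← hsum]; rfl
      simp only [this, map_sum, map_zsmul, b.toWeightBasis_repr_root, Finsupp.finsetSum_apply,
        Finsupp.smul_apply, Finsupp.single_apply]
      simp
    · exact hf.imp (fun h i => h.le i) fun h i => h.le i
    · rw [RootPairing.Base.height_eq_sum hsum]
      exact Finset.sum_coe_sort b.support f

/-- The coefficients of a weight in the basis of simple roots. -/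
def intCoeff (α : Weight K H L) : b.support → ℤ := (exists_intCoeff b α).choose

/-- The height of a weight. -/
def weightHeight (α : Weight K H L) : ℤ := ∑ i, intCoeff b α i

theorem repr_eq_intCoeff (α : Weight K H L) (i : b.support) :
    b.toWeightBasis.repr α.toLinear i = intCoeff b α i := (exists_intCoeff b α).choose_spec.1 i

theorem intCoeff_sign (α : Weight K H L) :
    (∀ i, 0 ≤ intCoeff b α i) ∨ (∀ i, intCoeff b α i ≤ 0) :=
  (exists_intCoeff b α).choose_spec.2.1

theorem weightHeight_eq_height (α : H.root) : weightHeight b α = b.height α :=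
  (exists_intCoeff b α.1).choose_spec.2.2 α.2

theorem isPos_iff_weightHeight (α : H.root) : b.IsPos α ↔ 0 < weightHeight b α := by
  rw [weightHeight_eq_height]; rfl

theorem contains_iff (i₀ : b.support) (α : H.root) :
    Contains b i₀ α ↔ intCoeff b α.1 i₀ ≠ 0 := by
  have : Contains b i₀ α ↔ b.toWeightBasis.repr α.1.toLinear i₀ ≠ 0 := Iff.rfl
  rw [this, repr_eq_intCoeff]
  exact_mod_cast Iff.rfl

theorem intCoeff_add {α β γ : Weight K H L} (h : (γ : H → K) = α + β) (i : b.support) :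
    intCoeff b γ i = intCoeff b α i + intCoeff b β i := by
  have hl : γ.toLinear = α.toLinear + β.toLinear := by ext x; exact congrFun h x
  have := congrArg (fun v => b.toWeightBasis.repr v i) hl
  simp only [map_add, Finsupp.add_apply, repr_eq_intCoeff] at this
  exact_mod_cast this

theorem weightHeight_add {α β γ : Weight K H L} (h : (γ : H → K) = α + β) :
    weightHeight b γ = weightHeight b α + weightHeight b β := by
  simp only [weightHeight, intCoeff_add b h, Finset.sum_add_distrib]

theorem intCoeff_neg (α : Weight K H L) (i : b.support) :
    intCoeff b (-α) i = -intCoeff b α i := by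
  have := congrArg (fun v => b.toWeightBasis.repr v i) (Weight.toLinear_neg (α := α))
  simp only [map_neg, Finsupp.neg_apply, repr_eq_intCoeff] at this
  exact_mod_cast this

theorem weightHeight_neg (α : Weight K H L) : weightHeight b (-α) = -weightHeight b α := by
  simp only [weightHeight, intCoeff_neg b, Finset.sum_neg_distrib]

theorem weightHeight_eq_zero_iff {α : Weight K H L} : weightHeight b α = 0 ↔ α.IsZero := by
  refine ⟨fun h => ?_, fun h => ?_⟩
  · by_contra hα
    have := weightHeight_eq_height b ⟨α, by simpa using hα⟩
    exact b.height_ne_zero _ (this.symm.trans h)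
  · have := weightHeight_add b (α := α) (β := α) (γ := α) (by rw [h.eq, add_zero])
    lia

/-- The coefficients of a weight never have mixed signs, so a single nonzero one decides the sign of
the height. -/
theorem weightHeight_pos_of_intCoeff_pos {α : Weight K H L} {i : b.support}
    (h : 0 < intCoeff b α i) : 0 < weightHeight b α := by
  rcases intCoeff_sign b α with h' | h'
  · exact Finset.sum_pos' (fun j _ => h' j) ⟨i, Finset.mem_univ i, h⟩
  · exact absurd (h' i) (not_le.2 h)

theorem weightHeight_neg_of_intCoeff_neg {α : Weight K H L} {i : b.support}
    (h : intCoeff b α i < 0) : weightHeight b α < 0 := by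
  have := weightHeight_pos_of_intCoeff_pos b (α := -α) (i := i) (by rw [intCoeff_neg]; lia)
  rw [weightHeight_neg] at this
  lia

end Weights

section Adapted

open LieAlgebra LieAlgebra.IsKilling LieModule Module

variable {K L : Type*} [Field K] [CharZero K] [LieRing L] [LieAlgebra K L]
  [FiniteDimensional K L] [IsKilling K L] {H : LieSubalgebra K L} [H.IsCartanSubalgebra]
  [IsTriangularizable K H L]

/-! ### The normalized invariant form -/

/-- An invariant form on `L` that is dual to the form `B` on the weights. -/
structure IsAdapted (B : (rootSystem H).InvariantForm) (X : Weight K H L → L)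
    (κ : LinearMap.BilinForm K L) : Prop where
  symm : ∀ x y, κ x y = κ y x
  invariant : ∀ x y z, κ ⁅x, y⁆ z = κ x ⁅y, z⁆
  exists_eq : ∀ f : L →ₗ[K] K, ∃ x, κ x = f
  orthogonal : ∀ (α β : H → K) (x y : L), x ∈ rootSpace H α → y ∈ rootSpace H β →
    α + β ≠ 0 → κ x y = 0
  normalized : ∀ α : H.root, len B α * κ (X α) (X (-α)) = 1

/-- The form on the dual of the Cartan subalgebra that is induced by the Killing form. -/
def dualForm (u v : Dual K H) : K := u ((cartanEquivDual H).symm v)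

omit [CharZero K] [IsTriangularizable K H L] in
theorem dualForm_comm (u v : Dual K H) : dualForm u v = dualForm v u := by
  have h (u v : Dual K H) : dualForm u v =
      traceForm K H L ((cartanEquivDual H).symm u) ((cartanEquivDual H).symm v) := by
    change _ = cartanEquivDual H ((cartanEquivDual H).symm u) _
    rw [LinearEquiv.apply_symm_apply]; rfl
  rw [h, h, traceForm_comm]

theorem dualForm_root_ne_zero (β : H.root) :
    dualForm ((rootSystem H).root β) ((rootSystem H).root β) ≠ 0 :=
  root_apply_cartanEquivDual_symm_ne_zero (H.isNonZero_coe_root β)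

theorem dualForm_root_mul_two (β : H.root) (v : Dual K H) :
    dualForm ((rootSystem H).root β) v * 2 =
      v (coroot β.1) * dualForm ((rootSystem H).root β) ((rootSystem H).root β) := by
  have hne := dualForm_root_ne_zero β
  have hc : v (coroot β.1) = 2 * ((dualForm ((rootSystem H).root β) ((rootSystem H).root β))⁻¹ *
      dualForm v ((rootSystem H).root β)) := by
    rw [coroot, map_nsmul, map_smul, nsmul_eq_mul, smul_eq_mul]; rfl
  rw [hc, dualForm_comm]
  field_simp

theorem form_root_mul_two (B : (rootSystem H).InvariantForm) (β : H.root) (v : Dual K H) :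
    B.form ((rootSystem H).root β) v * 2 =
      v (coroot β.1) * B.form ((rootSystem H).root β) ((rootSystem H).root β) := by
  have h := B.apply_reflection_reflection β ((rootSystem H).root β) v
  rw [RootPairing.reflection_apply_self, RootPairing.reflection_apply] at h
  have h' : (rootSystem H).coroot' β v = v (coroot β.1) := rfl
  rw [h'] at h
  simp only [map_neg, LinearMap.neg_apply, map_sub, map_smul, smul_eq_mul] at h
  linear_combination -h

/-- The invariant form of a simple root system is unique up to a scalar. -/
theorem exists_form_eq_mul [LieAlgebra.IsSimple K L] (B : (rootSystem H).InvariantForm) :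
    ∃ c : K, c ≠ 0 ∧ ∀ β : H.root,
      B.form ((rootSystem H).root β) ((rootSystem H).root β) =
        c * dualForm ((rootSystem H).root β) ((rootSystem H).root β) := by
  have hirr := instIsIrreducibleRootSystem_of_isSimple (K := K) (L := L) (H := H)
  have hq := dualForm_root_ne_zero (K := K) (L := L) (H := H)
  obtain ⟨β₀⟩ : Nonempty H.root := by
    have := hirr.nontrivial
    by_contra hne
    rw [not_nonempty_iff] at hne
    have h := RootPairing.IsRootSystem.span_root_eq_top (P := rootSystem H)
    rw [Set.range_eq_empty, Submodule.span_empty] at h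
    exact bot_ne_top h
  let c := B.form ((rootSystem H).root β₀) ((rootSystem H).root β₀) /
    dualForm ((rootSystem H).root β₀) ((rootSystem H).root β₀)
  have hc : B.form ((rootSystem H).root β₀) ((rootSystem H).root β₀) =
      c * dualForm ((rootSystem H).root β₀) ((rootSystem H).root β₀) := by
    rw [div_mul_cancel₀ _ (hq β₀)]
  -- `W` consists of the vectors on which `B` and `c` times the Killing-induced form agree against
  -- all roots. It is stable under reflections and contains `β₀`, so irreducibility makes it
  -- everything.
  let W : Submodule K (Dual K H) :=
    { carrier := {v | ∀ β : H.root, B.form ((rootSystem H).root β) v =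
        c * dualForm ((rootSystem H).root β) v}
      add_mem' := fun {u v} hu hv β => by
        simp only [Set.mem_ofPred_eq] at hu hv
        rw [map_add, hu, hv, dualForm, dualForm, dualForm, map_add, map_add, mul_add]
      zero_mem' := fun β => by simp [dualForm]
      smul_mem' := fun a v hv β => by
        simp only [Set.mem_ofPred_eq] at hv
        rw [map_smul, hv, dualForm, dualForm, map_smul, map_smul, smul_eq_mul, smul_eq_mul]; ring }
  have mem_W {β : H.root} (h : B.form ((rootSystem H).root β) ((rootSystem H).root β) =
      c * dualForm ((rootSystem H).root β) ((rootSystem H).root β)) :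
      (rootSystem H).root β ∈ W := fun γ => by
    have h₁ := form_root_mul_two B β ((rootSystem H).root γ)
    have h₂ := dualForm_root_mul_two β ((rootSystem H).root γ)
    have h₃ := form_root_mul_two B γ ((rootSystem H).root β)
    have h₄ := dualForm_root_mul_two γ ((rootSystem H).root β)
    have h₅ : B.form ((rootSystem H).root γ) ((rootSystem H).root β) =
      B.form ((rootSystem H).root β) ((rootSystem H).root γ) := (B.symm.eq _ _).symm
    have h₆ := dualForm_comm ((rootSystem H).root γ) ((rootSystem H).root β)
    rw [h₅, h₆]
    have two : (2 : K) ≠ 0 := two_ne_zero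
    apply mul_right_cancel₀ two
    rw [h₁, h, mul_assoc, h₂]; ring
  have hW : W = ⊤ := by
    refine hirr.eq_top_of_invtSubmodule_reflection W (fun β => ?_) fun h => ?_
    · rw [Module.End.mem_invtSubmodule]
      intro v hv
      rw [Submodule.mem_comap]
      change (rootSystem H).reflection β v ∈ W
      rw [RootPairing.reflection_apply]
      have h' : (rootSystem H).coroot' β v = v (coroot β.1) := rfl
      rw [h']
      by_cases h0 : v (coroot β.1) = 0
      · rwa [h0, zero_smul, sub_zero]
      -- If the reflection moves `v`, the two formulas for the pairing of `β` with `v` can be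
      -- divided by `v (coroot β)`; this gives the ratio `c` for `β` itself, hence `β` is in `W`.
      · refine W.sub_mem hv (W.smul_mem _ (mem_W ?_))
        have h₁ := form_root_mul_two B β v
        have h₂ := dualForm_root_mul_two β v
        rw [hv β] at h₁
        apply mul_left_cancel₀ h0
        linear_combination c * h₂ - h₁
    · have := mem_W hc
      rw [h, Submodule.mem_bot] at this
      exact (rootSystem H).ne_zero β₀ this
  refine ⟨c, div_ne_zero (B.ne_zero β₀) (hq β₀), fun β => ?_⟩
  have : (rootSystem H).root β ∈ W := hW ▸ Submodule.mem_top
  exact this β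

/-- The form is the Killing form divided by the scalar `c` of `exists_form_eq_mul`. Evaluating `α`
on `[X α, X (-α)] = H_α` shows that the Killing product of `X α` and `X (-α)`, times the
Killing-induced square of `α`, equals 2; this is the normalization. -/
theorem exists_isAdapted [LieAlgebra.IsSimple K L] (B : (rootSystem H).InvariantForm)
    {X : Weight K H L → L} (hX : IsCartanWeyl X) : ∃ κ, IsAdapted B X κ := by
  obtain ⟨c, hc, hB⟩ := exists_form_eq_mul B
  refine ⟨c⁻¹ • killingForm K L, fun x y => ?_, fun x y z => ?_, fun f => ?_,
    fun α β x y hx hy h => ?_, fun α => ?_⟩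
  · simp only [LinearMap.smul_apply]
    rw [LieModule.traceForm_comm]
  · simp only [LinearMap.smul_apply]
    rw [LieModule.traceForm_apply_lie_apply]
  · have hnd : (killingForm K L).Nondegenerate := IsKilling.killingForm_nondegenerate K L
    refine ⟨c • ((killingForm K L).toDual hnd).symm f, ?_⟩
    rw [map_smul, LinearMap.smul_apply, smul_smul, mul_inv_cancel₀ hc, one_smul]
    ext y
    exact LinearMap.BilinForm.apply_toDual_symm_apply _ _
  · simp only [LinearMap.smul_apply]
    rw [killingForm_apply_eq_zero_of_mem_rootSpace_of_add_ne_zero K L H hx hy h, smul_zero]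
  · have hα := H.isNonZero_coe_root α
    have h₁ := lie_eq_killingForm_smul_of_mem_rootSpace_of_mem_rootSpace_neg (hX.mem α.1 hα)
      (hX.mem (-α.1) hα.neg)
    rw [hX.lie α.1 hα] at h₁
    have h₂ : coroot α.1 = killingForm K L (X α.1) (X (-α.1)) •
        (cartanEquivDual H).symm α.1.toLinear := Subtype.ext h₁
    have h₃ := congrArg ((rootSystem H).root α) h₂
    rw [map_smul, smul_eq_mul] at h₃
    have h₄ : (rootSystem H).root α (coroot α.1) = 2 := root_apply_coroot hα
    change _ = _ * dualForm ((rootSystem H).root α) ((rootSystem H).root α) at h₃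
    rw [h₄] at h₃
    rw [len, hB, LinearMap.smul_apply, LinearMap.smul_apply, smul_eq_mul]
    field_simp
    linear_combination -h₃

end Adapted

section Sklyanin

open LieAlgebra LieAlgebra.IsKilling LieModule Module

variable {K L : Type*} [Field K] [CharZero K] [LieRing L] [LieAlgebra K L]
  [FiniteDimensional K L] [IsKilling K L] {H : LieSubalgebra K L} [H.IsCartanSubalgebra]
  [IsTriangularizable K H L]

/-! ### The operator of the Drinfeld-Sklyanin element -/

variable (b : (rootSystem H).Base)

/-- The eigenvalue of the operator of the Drinfeld-Sklyanin element on the root space of `α`. -/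
def rCoef (α : Weight K H L) : K :=
  if 0 < weightHeight b α then 1 else if weightHeight b α = 0 then 2⁻¹ else 0

theorem rCoef_of_pos {α : Weight K H L} (h : 0 < weightHeight b α) : rCoef b α = 1 := if_pos h

theorem rCoef_of_zero {α : Weight K H L} (h : weightHeight b α = 0) : rCoef b α = 2⁻¹ := by
  rw [rCoef, if_neg (by lia), if_pos h]

theorem rCoef_of_neg {α : Weight K H L} (h : weightHeight b α < 0) : rCoef b α = 0 := by
  rw [rCoef, if_neg (by lia), if_neg (by lia)]

theorem rCoef_neg (α : Weight K H L) : rCoef b (-α) = 1 - rCoef b α := by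
  have h := weightHeight_neg b α
  rcases lt_trichotomy (weightHeight b α) 0 with h' | h' | h'
  · rw [rCoef_of_neg b h', rCoef_of_pos b (by lia), sub_zero]
  · rw [rCoef_of_zero b h', rCoef_of_zero b (by lia)]; norm_num
  · rw [rCoef_of_pos b h', rCoef_of_neg b (by lia), sub_self]

/-- The operator of the Drinfeld-Sklyanin element. -/
def rOp : L →ₗ[K] L := weightMul (rCoef b)

/-- The transpose of the operator of the Drinfeld-Sklyanin element. -/
def rOpT : L →ₗ[K] L := weightMul fun α => 1 - rCoef b α

theorem rOpT_apply (x : L) : rOpT b x = x - rOp b x := by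
  rw [rOpT, weightMul_sub, weightMul_one]; rfl

/-- Two weights of nonnegative height, not both zero, add up to positive height, where the
eigenvalue is 1. For two zero weights the eigenvalue 1/2 would spoil the identity, but there the
bracket vanishes. -/
theorem rOp_lie_rOp (x y : L) : rOp b ⁅rOp b x, rOp b y⁆ = ⁅rOp b x, rOp b y⁆ := by
  refine weightMul_lie (fun α β γ hγ hne => ?_) x y
  have h := weightHeight_add b hγ
  rw [← weightHeight_eq_zero_iff b, ← weightHeight_eq_zero_iff b] at hne
  by_cases hα : weightHeight b α < 0
  · simp [rCoef_of_neg b hα]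
  by_cases hβ : weightHeight b β < 0
  · simp [rCoef_of_neg b hβ]
  rw [rCoef_of_pos b (α := γ) (by lia), one_mul]

theorem rOp_lie_rOpT (x y : L) : rOp b ⁅rOpT b x, rOpT b y⁆ = 0 := by
  have : rOp b ⁅rOpT b x, rOpT b y⁆ = ⁅weightMul (fun _ : Weight K H L => (0 : K)) x,
      weightMul (fun _ : Weight K H L => (0 : K)) y⁆ := by
    refine weightMul_lie (fun α β γ hγ hne => ?_) x y
    have h := weightHeight_add b hγ
    rw [← weightHeight_eq_zero_iff b, ← weightHeight_eq_zero_iff b] at hne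
    by_cases hα : 0 < weightHeight b α
    · simp [rCoef_of_pos b hα]
    by_cases hβ : 0 < weightHeight b β
    · simp [rCoef_of_pos b hβ]
    rw [rCoef_of_neg b (α := γ) (by lia), zero_mul, zero_mul]
  rw [this, weightMul_zero, zero_lie]

/-- The dual bracket of the Drinfeld-Sklyanin cobracket, carried over to `L`. -/
def star (x y : L) : L := ⁅rOpT b x, rOpT b y⁆ - ⁅rOp b x, rOp b y⁆

/-- Together with `rOpT_star`, this makes `-rOp` and `rOpT` homomorphisms from `star` to the Lie
bracket, so nested `star` brackets reduce to nested Lie brackets. -/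
theorem rOp_star (x y : L) : rOp b (star b x y) = -⁅rOp b x, rOp b y⁆ := by
  rw [star, map_sub, rOp_lie_rOp, rOp_lie_rOpT, zero_sub]

theorem rOpT_star (x y : L) : rOpT b (star b x y) = ⁅rOpT b x, rOpT b y⁆ := by
  rw [rOpT_apply, rOp_star, star]; abel

theorem star_star (x y z : L) : star b x (star b y z) =
    ⁅rOpT b x, ⁅rOpT b y, rOpT b z⁆⁆ + ⁅rOp b x, ⁅rOp b y, rOp b z⁆⁆ := by
  rw [star, rOp_star, rOpT_star, lie_neg, sub_neg_eq_add]

theorem star_jacobi (x y z : L) :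
    star b x (star b y z) + star b z (star b x y) + star b y (star b z x) = 0 := by
  have h₁ := lie_jacobi (rOpT b x) (rOpT b y) (rOpT b z)
  have h₂ := lie_jacobi (rOp b x) (rOp b y) (rOp b z)
  rw [star_star, star_star, star_star]
  rw [← add_zero (0 : L)]
  nth_rw 1 [← h₁]
  rw [← h₂]
  abel

theorem star_comm (x y : L) : star b x y = -star b y x := by
  rw [star, star, ← lie_skew, ← lie_skew (rOp b x)]; abel

/-- The factor vanishes exactly when the heights of `α` and `β` have strictly opposite signs or are
both zero. The invariance properties of the cobracket rest on this. -/
theorem star_of_mem {α β : Weight K H L} {x y : L} (hx : x ∈ rootSpace H α)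
    (hy : y ∈ rootSpace H β) : star b x y = (1 - rCoef b α - rCoef b β) • ⁅x, y⁆ := by
  rw [star, rOpT, rOp, weightMul_apply _ hx, weightMul_apply _ hy, weightMul_apply _ hx,
    weightMul_apply _ hy, smul_lie, smul_lie, lie_smul, lie_smul, smul_smul, smul_smul, ← sub_smul]
  congr 1; ring

/-! ### The Cartan matrix -/

open Classical in
-- A kernel vector gives a combination of simple roots that vanishes on all simple coroots, which
-- form a basis; independence of the simple roots finishes.
theorem isUnit_cartanMat : IsUnit (cartanMat b) := by
  rw [← Matrix.mulVec_injective_iff_isUnit]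
  refine (injective_iff_map_eq_zero (cartanMat b).mulVecLin).2 fun v hv => ?_
  have h0 : ∑ j, v j • b.toWeightBasis j = 0 := by
    refine b.toCoweightBasis.ext fun i => ?_
    rw [LinearMap.zero_apply, b.toCoweightBasis_apply]
    have hi := congrFun hv i
    simp only [Matrix.mulVecLin_apply, Matrix.mulVec, dotProduct, Pi.zero_apply] at hi
    rw [← hi, LinearMap.sum_apply]
    refine Finset.sum_congr rfl fun j _ => ?_
    rw [LinearMap.smul_apply, b.toWeightBasis_apply, smul_eq_mul, mul_comm]
    rfl
  exact funext fun j => Fintype.linearIndependent_iff.1 b.toWeightBasis.linearIndependent v h0 j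

variable {b} {B : (rootSystem H).InvariantForm} {X : Weight K H L → L}
  {κ : LinearMap.BilinForm K L}

theorem len_ne_zero (α : H.root) : len B α ≠ 0 := div_ne_zero (B.ne_zero α) two_ne_zero

namespace IsCartanWeyl

variable (hX : IsCartanWeyl X)

include hX

theorem ne_zero {α : Weight K H L} (hα : α.IsNonZero) : X α ≠ 0 := fun h => by
  have h' := hX.lie α hα
  rw [h, zero_lie] at h'
  exact hα (coroot_eq_zero_iff.1 (Subtype.ext h'.symm))

theorem exists_smul_eq {α : Weight K H L} (hα : α.IsNonZero) {y : L} (hy : y ∈ rootSpace H α) :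
    ∃ c : K, c • X α = y :=
  exists_smul_eq_of_mem_rootSpace hα (hX.mem α hα) (hX.ne_zero hα) hy

theorem len_mul_apply_coroot (hκ : IsAdapted B X κ) (α : H.root) (h : H) :
    len B α * κ (coroot α.1 : L) (h : L) = α.1 h := by
  have hα := H.isNonZero_coe_root α
  have h₁ : ⁅X (-α.1), (h : L)⁆ = α.1 h • X (-α.1) := by
    rw [← lie_skew]
    have : ⁅(h : L), X (-α.1)⁆ = (-α.1 : Weight K H L) h • X (-α.1) :=
      lie_eq_smul_of_mem_rootSpace (hX.mem _ hα.neg) h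
    rw [this, Weight.coe_neg, Pi.neg_apply, neg_smul, neg_neg]
  rw [← hX.lie α.1 hα, hκ.invariant, h₁, map_smul, smul_eq_mul]
  linear_combination α.1 h * hκ.normalized α

open Classical in
-- For `y = H_l` one has `κ(H_l, H_j) = a_{jl} / d_l`, so the coefficients are those of the product
-- of the inverse Cartan matrix with the Cartan matrix. Hence the Cartan part of `r` acts on `H` as
-- half the identity.
theorem sum_cartanCoeff (hκ : IsAdapted B X κ) {y : L} (hy : y ∈ H) :
    ∑ i : b.support, ∑ j : b.support, (cartanCoeff b B i j * κ y (coroot (j : H.root).1 : L)) •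
      (coroot (i : H.root).1 : L) = y := by
  let F : L →ₗ[K] L := ∑ i : b.support, ∑ j : b.support,
    (cartanCoeff b B i j • κ.flip (coroot (j : H.root).1 : L)).smulRight (coroot (i : H.root).1 : L)
  have hF (z : L) : F z = ∑ i : b.support, ∑ j : b.support,
      (cartanCoeff b B i j * κ z (coroot (j : H.root).1 : L)) • (coroot (i : H.root).1 : L) := by
    simp [F, LinearMap.sum_apply]
  have key : F ∘ₗ H.toSubmodule.subtype = H.toSubmodule.subtype := by
    refine b.toCoweightBasis.ext fun l => ?_
    rw [b.toCoweightBasis_apply]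
    change F (coroot (l : H.root).1 : L) = (coroot (l : H.root).1 : L)
    have hl := len_ne_zero (B := B) l
    have h₁ (j : b.support) : κ (coroot (l : H.root).1 : L) (coroot (j : H.root).1 : L) =
        cartanMat b j l * (len B l)⁻¹ := by
      rw [eq_mul_inv_iff_mul_eq₀ hl, mul_comm, hX.len_mul_apply_coroot hκ]; rfl
    have h₂ (i : b.support) : ∑ j, cartanCoeff b B i j * (cartanMat b j l * (len B l)⁻¹) =
        if i = l then 1 else 0 := by
      have h₃ := congrFun (congrFun (Matrix.nonsing_inv_mul (cartanMat b)
        ((Matrix.isUnit_iff_isUnit_det _).1 (isUnit_cartanMat b))) i) l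
      rw [Matrix.mul_apply, Matrix.one_apply] at h₃
      have h₄ : ∑ j, cartanCoeff b B i j * (cartanMat b j l * (len B l)⁻¹) =
          len B i * (len B l)⁻¹ * ∑ j, (cartanMat b)⁻¹ i j * cartanMat b j l := by
        rw [Finset.mul_sum]
        exact Finset.sum_congr rfl fun j _ => by rw [cartanCoeff]; ring
      rw [h₄, h₃]
      split_ifs with h
      · rw [h, mul_one, mul_inv_cancel₀ hl]
      · rw [mul_zero]
    rw [hF]
    simp only [h₁, ← Finset.sum_smul, h₂, ite_smul, one_smul, zero_smul]
    simp
  rw [← hF]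
  exact LinearMap.congr_fun key ⟨y, hy⟩

end IsCartanWeyl

namespace IsAdapted

variable (hκ : IsAdapted B X κ)

include hκ

theorem eq_zero {α β : Weight K H L} {x y : L} (hx : x ∈ rootSpace H α)
    (hy : y ∈ rootSpace H β) (h : α ≠ -β) : κ x y = 0 :=
  hκ.orthogonal α β x y hx hy fun h' => h <| Weight.ext fun z => by
    have := congrFun h' z
    rw [Weight.coe_neg, Pi.neg_apply, eq_neg_iff_add_eq_zero]; exact this

theorem apply_weightMul (c : Weight K H L → K) (x y : L) :
    κ x (weightMul c y) = κ (weightMul (fun α => c (-α)) x) y := by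
  induction x using rootSpace_induction (H := H) with
  | mem α x hx =>
    induction y using rootSpace_induction (H := H) with
    | mem β y hy =>
      rw [weightMul_apply _ hx, weightMul_apply _ hy, map_smul, map_smul, LinearMap.smul_apply]
      by_cases h : α = -β
      · rw [h, neg_neg]
      · rw [hκ.eq_zero hx hy h, smul_zero, smul_zero]
    | zero => simp
    | add y z hy hz => simp only [map_add, hy, hz]
  | zero => simp
  | add x z hx hz => simp only [map_add, LinearMap.add_apply, hx, hz]

/-- `κ` pairs opposite root spaces, and the eigenvalues at `α` and `-α` add up to 1. -/
theorem apply_rOp (x y : L) : κ x (rOp b y) = κ (rOpT b x) y := by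
  rw [rOp, hκ.apply_weightMul]
  simp only [rCoef_neg]; rfl

/-- Against a vector of root weight `β`, only the summand with `X_{-β}` in the second factor can
survive; it occurs when `β` is positive, and the normalization of `κ` cancels `d_β`. -/
theorem pair_rMatrix (hX : IsCartanWeyl X) (x y : L) :
    pair (κ x) (κ y) (rMatrix b B X) = κ x (rOp b y) := by
  classical
  induction y using rootSpace_induction (H := H) with
  | zero => simp
  | add y z hy hz => rw [map_add, map_add, pair_add_right, LinearMap.add_apply, hy, hz, map_add]
  | mem β y hy =>
    rw [rOp, weightMul_apply _ hy, map_smul, smul_eq_mul]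
    simp only [rMatrix, map_add, map_sum, map_smul, pair_tmul, smul_eq_mul]
    have coroot_mem (α : Weight K H L) : (coroot α : L) ∈ rootSpace H (0 : H → K) :=
      mem_cartan_iff.1 (coroot α).2
    have mem_neg (α : H.root) : X (-α.1) ∈ rootSpace H (-α.1 : Weight K H L) :=
      hX.mem _ (H.isNonZero_coe_root α).neg
    by_cases hβ : β.IsZero
    · rw [rCoef_of_zero b ((weightHeight_eq_zero_iff b).2 hβ), Finset.sum_eq_zero, zero_add]
      · have hyH : y ∈ H := by rw [mem_cartan_iff]; rwa [hβ.eq] at hy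
        conv_rhs => rw [← hX.sum_cartanCoeff (b := b) hκ hyH]
        simp only [map_sum, map_smul, smul_eq_mul]
        congr 1
        exact Finset.sum_congr rfl fun i _ => Finset.sum_congr rfl fun j _ => by ring
      · intro α _
        rw [hκ.eq_zero hy (mem_neg α), mul_zero, mul_zero]
        rw [neg_neg]
        rintro rfl
        exact H.isNonZero_coe_root α hβ
    · have h₀ : ∀ i : b.support, κ y (coroot (i : H.root).1 : L) = 0 := fun i =>
        hκ.orthogonal β 0 _ _ hy (coroot_mem _) (by rwa [add_zero])
      simp only [h₀, mul_zero, Finset.sum_const_zero, add_zero]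
      let β' : H.root := ⟨β, by simpa using hβ⟩
      by_cases hpos : 0 < weightHeight b β
      · rw [rCoef_of_pos b hpos, Finset.sum_eq_single β']
        · obtain ⟨c, rfl⟩ := hX.exists_smul_eq hβ hy
          have hn := hκ.normalized β'
          change len B β' * (κ x (X β) * κ (c • X β) (X (-β))) = _
          change len B β' * κ (X β) (X (-β)) = 1 at hn
          rw [map_smul, map_smul, LinearMap.smul_apply, smul_eq_mul, smul_eq_mul]
          linear_combination c * κ x (X β) * hn
        · intro α _ hne
          rw [hκ.eq_zero hy (mem_neg α), mul_zero, mul_zero]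
          rw [neg_neg]
          exact fun h => hne (Subtype.ext h.symm)
        · intro h
          refine absurd (Finset.mem_filter.2 ⟨Finset.mem_univ _, ?_⟩) h
          rw [isPos_iff_weightHeight]; exact hpos
      · have hne := (weightHeight_eq_zero_iff b).not.2 hβ
        rw [rCoef_of_neg b (by lia), zero_mul]
        refine Finset.sum_eq_zero fun α hα => ?_
        rw [hκ.eq_zero hy (mem_neg α), mul_zero, mul_zero]
        rw [neg_neg]
        rintro rfl
        exact hpos ((isPos_iff_weightHeight b α).1 (Finset.mem_filter.1 hα).2)

/-- Invariance of `κ` gives the bracket `[T x, y] - [x, R y]`, with R = `rOp` and T = `rOpT`.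
Writing `y = T y + R y` and `x = T x + R x` cancels the mixed terms. -/
theorem dualBracket_cobracket (hX : IsCartanWeyl X) (x y : L) :
    dualBracket (cobracket b B X) (κ x) (κ y) = κ (star b x y) := by
  ext ξ
  have had (u : L) : κ u ∘ₗ toEnd K L L ξ = κ ⁅u, ξ⁆ := by
    ext z; exact (hκ.invariant u ξ z).symm
  rw [dualBracket_apply]
  change pair (κ x) (κ y) ⁅ξ, rMatrix b B X⁆ = _
  rw [pair_lie, had, had, hκ.pair_rMatrix hX, hκ.pair_rMatrix hX, hκ.apply_rOp x ⁅y, ξ⁆,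
    ← hκ.invariant, hκ.symm ⁅x, ξ⁆, ← hκ.invariant, ← lie_skew (rOp b y) x, star, rOpT_apply b y,
    lie_sub, rOpT_apply b x]
  simp only [sub_lie, map_sub, map_neg, LinearMap.sub_apply, LinearMap.neg_apply]
  ring

theorem isLieBialgebra (hX : IsCartanWeyl X) : IsLieBialgebra (cobracket b B X) where
  toIsLieCoalgebra := by
    refine .of_dualBracket (fun f g ξ => ?_) fun f g h ξ => ?_ <;>
    obtain ⟨x, rfl⟩ := hκ.exists_eq f <;> obtain ⟨y, rfl⟩ := hκ.exists_eq g
    · simp only [hκ.dualBracket_cobracket hX]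
      rw [star_comm, map_neg]; rfl
    · obtain ⟨z, rfl⟩ := hκ.exists_eq h
      simp only [hκ.dualBracket_cobracket hX]
      rw [← LinearMap.add_apply, ← LinearMap.add_apply, ← map_add, ← map_add, star_jacobi]
      simp
  cocycle x y := lie_lie x y (rMatrix b B X)

/-- Compatibility of the cobracket with operators that are scalar on root spaces. -/
theorem map_weightMul_cobracket (hX : IsCartanWeyl X) {a d e : Weight K H L → K}
    (h : ∀ α β γ : Weight K H L, (α : H → K) + β + γ = 0 →
      (1 - rCoef b α - rCoef b β) * (a (-α) * a (-β) * e γ - d γ) = 0) (ξ : L) :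
    TensorProduct.map (weightMul a) (weightMul a) (cobracket b B X (weightMul e ξ)) =
      cobracket b B X (weightMul d ξ) := by
  refine pair_ext fun f g => ?_
  obtain ⟨x, rfl⟩ := hκ.exists_eq f
  obtain ⟨y, rfl⟩ := hκ.exists_eq g
  -- The transpose of `weightMul a` has eigenvalue `a (-α)` on the root space of `α`; hence the
  -- signs in the hypothesis `h`.
  have had (u : L) : κ u ∘ₗ weightMul a = κ (weightMul (fun α => a (-α)) u) := by
    ext z; exact hκ.apply_weightMul a u z
  rw [pair_map, had, had, ← dualBracket_apply, ← dualBracket_apply, hκ.dualBracket_cobracket hX,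
    hκ.dualBracket_cobracket hX]
  induction ξ using rootSpace_induction (H := H) with
  | zero => simp
  | add ξ η hξ hη => simp only [map_add, hξ, hη]
  | mem γ ξ hξ =>
  induction x using rootSpace_induction (H := H) with
  | zero => simp [star]
  | add x z hx hz =>
    simp only [star, map_add, map_sub, add_lie, LinearMap.add_apply, LinearMap.sub_apply]
      at hx hz ⊢
    linear_combination hx + hz
  | mem α x hx =>
  induction y using rootSpace_induction (H := H) with
  | zero => simp [star]
  | add y z hy hz =>
    simp only [star, map_add, map_sub, lie_add, LinearMap.add_apply, LinearMap.sub_apply]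
      at hy hz ⊢
    linear_combination hy + hz
  | mem β y hy =>
  rw [weightMul_apply _ hx, weightMul_apply _ hy, weightMul_apply _ hξ, weightMul_apply _ hξ,
    star_of_mem b (Submodule.smul_mem _ _ hx) (Submodule.smul_mem _ _ hy), star_of_mem b hx hy]
  simp only [smul_lie, lie_smul, map_smul, LinearMap.smul_apply, smul_eq_mul]
  by_cases hz : κ ⁅x, y⁆ ξ = 0
  · simp [hz]
  · have hsum : (α : H → K) + β + γ = 0 := by
      by_contra hne
      exact hz (hκ.orthogonal _ _ _ _ (lie_mem_genWeightSpace_of_mem_genWeightSpace hx hy) hξ hne)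
    linear_combination κ ⁅x, y⁆ ξ * h α β γ hsum

end IsAdapted

end Sklyanin

section Borel

open LieAlgebra LieAlgebra.IsKilling LieModule Module

variable {K L : Type*} [Field K] [CharZero K] [LieRing L] [LieAlgebra K L]
  [FiniteDimensional K L] [IsKilling K L] {H : LieSubalgebra K L} [H.IsCartanSubalgebra]
  [IsTriangularizable K H L]

/-! ### Projections onto sums of root spaces -/

open Classical in
/-- The indicator function of a set of weights. -/
def indicator (S : Weight K H L → Prop) (α : Weight K H L) : K := if S α then 1 else 0

omit [CharZero K] [FiniteDimensional K L] [IsKilling K L] [IsTriangularizable K H L] in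
theorem indicator_of {S : Weight K H L → Prop} {α : Weight K H L} (h : S α) :
    indicator S α = 1 := if_pos h

omit [CharZero K] [FiniteDimensional K L] [IsKilling K L] [IsTriangularizable K H L] in
theorem indicator_of_not {S : Weight K H L → Prop} {α : Weight K H L} (h : ¬ S α) :
    indicator S α = 0 := if_neg h

/-- The projection onto the sum of the root spaces of the weights in `S`. -/
def weightProj (S : Weight K H L → Prop) : L →ₗ[K] L := weightMul (indicator S)

omit [CharZero K] [IsKilling K L] in
theorem weightProj_of_mem {S : Weight K H L → Prop} {α : Weight K H L} {x : L} (h : S α)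
    (hx : x ∈ rootSpace H α) : weightProj S x = x := by
  rw [weightProj, weightMul_apply _ hx, indicator_of h, one_smul]

omit [CharZero K] [IsKilling K L] in
theorem weightProj_of_not_mem {S : Weight K H L → Prop} {α : Weight K H L} {x : L} (h : ¬ S α)
    (hx : x ∈ rootSpace H α) : weightProj S x = 0 := by
  rw [weightProj, weightMul_apply _ hx, indicator_of_not h, zero_smul]

omit [CharZero K] [IsKilling K L] in
theorem weightProj_of_mem_cartan {S : Weight K H L → Prop} {x : L}
    (h : ∀ α : Weight K H L, α.IsZero → S α) (hx : x ∈ H) : weightProj S x = x := by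
  -- The zero functional is a `Weight` only if its root space is nonzero, and a nonzero `x`
  -- witnesses this.
  by_cases hx0 : x = 0
  · rw [hx0, map_zero]
  rw [mem_cartan_iff] at hx
  let α : Weight K H L := ⟨0, fun (h : rootSpace H (0 : H → K) = ⊥) =>
    hx0 (by rw [h] at hx; exact (LieSubmodule.mem_bot _).1 hx)⟩
  exact weightProj_of_mem (α := α) (h α rfl) hx

omit [CharZero K] [IsKilling K L] in
theorem weightProj_weightProj (S T : Weight K H L → Prop) (x : L) :
    weightProj S (weightProj T x) = weightProj (fun α => S α ∧ T α) x := by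
  rw [weightProj, weightProj, weightMul_weightMul, weightProj]
  congr 2
  ext α
  by_cases hS : S α <;> by_cases hT : T α <;> simp [indicator, hS, hT]

omit [CharZero K] [IsKilling K L] in
theorem weightProj_mem {S : Weight K H L → Prop} {s : Submodule K L}
    (h : ∀ α : Weight K H L, S α → (rootSpace H α).toSubmodule ≤ s) (x : L) :
    weightProj S x ∈ s :=
  weightMul_mem (fun α hα => h α <| by
    by_contra hS
    exact hα (indicator_of_not hS)) x

/-- The sum of the root spaces of a set of weights that is closed under addition. -/
def weightSubalgebra (S : Weight K H L → Prop)
    (hS : ∀ α β γ : Weight K H L, (γ : H → K) = α + β → S α → S β → S γ) :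
    LieSubalgebra K L where
  toSubmodule := LinearMap.eqLocus (weightProj S) LinearMap.id
  lie_mem' {x y} hx hy := by
    change weightProj S x = x at hx
    change weightProj S y = y at hy
    change weightProj S ⁅x, y⁆ = ⁅x, y⁆
    rw [← hx, ← hy]
    refine weightMul_lie (fun α β γ hγ _ => ?_) x y
    by_cases hα : S α
    · by_cases hβ : S β
      · rw [indicator_of (hS α β γ hγ hα hβ), one_mul]
      · rw [indicator_of_not hβ, mul_zero, mul_zero]
    · rw [indicator_of_not hα, zero_mul, mul_zero]

/-- Membership in a generated subalgebra becomes a fixed-point equation for a diagonal operator, to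
which the eigenvalue criteria for brackets and cobrackets apply. -/
theorem mem_lieSpan_iff {S : Weight K H L → Prop} {s : Set L}
    (hS : ∀ α β γ : Weight K H L, (γ : H → K) = α + β → S α → S β → S γ)
    (h₁ : ∀ x ∈ s, weightProj S x = x) (h₂ : ∀ α : Weight K H L, S α → ∀ x ∈ rootSpace H α, x ∈ s)
    {x : L} : x ∈ LieSubalgebra.lieSpan K L s ↔ weightProj S x = x := by
  refine ⟨fun hx => ?_, fun hx => ?_⟩
  · have : LieSubalgebra.lieSpan K L s ≤ weightSubalgebra S hS := LieSubalgebra.lieSpan_le.2 h₁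
    exact this hx
  · rw [← hx]
    exact weightProj_mem (s := (LieSubalgebra.lieSpan K L s).toSubmodule)
      (fun α hα y hy => LieSubalgebra.subset_lieSpan (h₂ α hα y hy)) x

/-! ### The negative Borel subalgebra and its subalgebra -/

variable (b : (rootSystem H).Base) (i₀ : b.support)

/-- The weights of the negative Borel subalgebra. -/
def IsNonpos (α : Weight K H L) : Prop := weightHeight b α ≤ 0

/-- The weights that do not contain the simple root `i₀`. -/
def IsFree (α : Weight K H L) : Prop := intCoeff b α i₀ = 0

theorem exists_root_neg {α : Weight K H L} (h : weightHeight b α < 0) :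
    ∃ β : H.root, b.IsPos β ∧ (α : H → K) = -β.1 ∧ -β.1 = α := by
  have hα : (-α).IsNonZero := fun h0 => by
    rw [← weightHeight_eq_zero_iff b, weightHeight_neg] at h0; lia
  refine ⟨⟨-α, by simpa using hα⟩, ?_, ?_, neg_neg α⟩
  · rw [isPos_iff_weightHeight, weightHeight_neg]; lia
  · rw [Weight.coe_neg, neg_neg]

theorem mem_negBorel_iff {x : L} : x ∈ negBorel b ↔ weightProj (IsNonpos b) x = x := by
  refine mem_lieSpan_iff (fun α β γ hγ hα hβ => ?_) ?_ fun α hα x hx => ?_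
  · have := weightHeight_add b hγ
    simp only [IsNonpos] at *
    lia
  · rintro x (hx | ⟨α, hα, hx⟩)
    · exact weightProj_of_mem_cartan (fun α hα => ((weightHeight_eq_zero_iff b).2 hα).le) hx
    · refine weightProj_of_mem (α := -α.1) ?_ hx
      rw [isPos_iff_weightHeight] at hα
      rw [IsNonpos, weightHeight_neg]
      lia
  · rcases (show weightHeight b α ≤ 0 from hα).lt_or_eq with h | h
    · obtain ⟨β, hβ, hαβ, -⟩ := exists_root_neg b h
      exact Or.inr ⟨β, hβ, hαβ ▸ hx⟩
    · left
      rw [mem_cartan_iff]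
      rwa [((weightHeight_eq_zero_iff b).1 h).eq] at hx

theorem mem_subBorel_iff {x : L} :
    x ∈ subBorel b i₀ ↔ weightProj (fun α => IsFree b i₀ α ∧ IsNonpos b α) x = x := by
  refine mem_lieSpan_iff (fun α β γ hγ hα hβ => ?_) ?_ fun α hα x hx => ?_
  · have h₁ := weightHeight_add b hγ
    have h₂ := intCoeff_add b hγ i₀
    simp only [IsNonpos, IsFree] at *
    lia
  · rintro x (hx | ⟨α, hα, hc, hx⟩)
    · refine weightProj_of_mem_cartan (fun α hα => ⟨?_, ((weightHeight_eq_zero_iff b).2 hα).le⟩) hx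
      have := intCoeff_add b (α := α) (β := α) (γ := α) (by rw [hα.eq, add_zero]) i₀
      rw [IsFree]
      lia
    · rw [isPos_iff_weightHeight] at hα
      rw [contains_iff, not_not] at hc
      refine weightProj_of_mem (α := -α.1) ⟨?_, ?_⟩ hx
      · rw [IsFree, intCoeff_neg, hc, neg_zero]
      · rw [IsNonpos, weightHeight_neg]
        lia
  · rcases (show weightHeight b α ≤ 0 from hα.2).lt_or_eq with h | h
    · obtain ⟨β, hβ, hαβ, hβα⟩ := exists_root_neg b h
      refine Or.inr ⟨β, hβ, ?_, hαβ ▸ hx⟩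
      rw [contains_iff, not_not]
      have h₁ : intCoeff b α i₀ = 0 := hα.1
      rw [← hβα, intCoeff_neg] at h₁
      lia
    · left
      rw [mem_cartan_iff]
      rwa [((weightHeight_eq_zero_iff b).1 h).eq] at hx

theorem rootSpace_le_negBorel (β : H.root) (hβ : b.IsPos β) {x : L}
    (hx : x ∈ rootSpace H (-β.1 : Weight K H L)) : x ∈ negBorel b :=
  LieSubalgebra.subset_lieSpan (Or.inr ⟨β, hβ, hx⟩)

theorem weightProj_mem_negBorel (x : L) : weightProj (IsNonpos b) x ∈ negBorel b := by
  rw [mem_negBorel_iff, weightProj_weightProj]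
  simp only [and_self]

theorem weightProj_mem_subBorel (x : L) :
    weightProj (fun α => IsFree b i₀ α ∧ IsNonpos b α) x ∈ subBorel b i₀ := by
  rw [mem_subBorel_iff, weightProj_weightProj]
  simp only [and_self]

/-- The linear projection onto the negative Borel subalgebra. -/
def projNegBorel : L →ₗ[K] negBorel b :=
  LinearMap.codRestrict (negBorel b).toSubmodule (weightProj (IsNonpos b))
    (weightProj_mem_negBorel b)

/-- The linear projection onto the subalgebra of the negative Borel subalgebra. -/
def projSubBorel : L →ₗ[K] subBorel b i₀ :=
  LinearMap.codRestrict (subBorel b i₀).toSubmodule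
    (weightProj (fun α => IsFree b i₀ α ∧ IsNonpos b α)) (weightProj_mem_subBorel b i₀)

theorem weightProj_isFree_mem {x : L} (hx : x ∈ negBorel b) :
    weightProj (IsFree b i₀) x ∈ subBorel b i₀ := by
  rw [mem_negBorel_iff] at hx
  rw [← hx, weightProj_weightProj]
  exact weightProj_mem_subBorel b i₀ x

theorem weightProj_isFree_of_mem {x : L} (hx : x ∈ subBorel b i₀) :
    weightProj (IsFree b i₀) x = x := by
  rw [mem_subBorel_iff] at hx
  rw [← hx, weightProj_weightProj]
  simp only [← and_assoc, and_self]

/-- For weights of the Borel subalgebra the coefficients at `i₀` are all at most zero, so a sum of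
two vanishes only if both do. On all of `L` the bracket of opposite root vectors would violate the
identity. -/
theorem weightProj_isFree_lie {x y : L} (hx : x ∈ negBorel b) (hy : y ∈ negBorel b) :
    weightProj (IsFree b i₀) ⁅x, y⁆ = ⁅weightProj (IsFree b i₀) x, weightProj (IsFree b i₀) y⁆ := by
  rw [mem_negBorel_iff] at hx hy
  rw [← hx, ← hy, weightProj_weightProj, weightProj_weightProj]
  refine weightMul_lie (fun α β γ hγ _ => ?_) x y
  by_cases hα : IsNonpos b α
  · by_cases hβ : IsNonpos b β
    · have h := intCoeff_add b hγ i₀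
      have hα' := (weightHeight_pos_of_intCoeff_pos b (α := α) (i := i₀)).mt (not_lt.2 hα)
      have hβ' := (weightHeight_pos_of_intCoeff_pos b (α := β) (i := i₀)).mt (not_lt.2 hβ)
      have : IsFree b i₀ γ ↔ IsFree b i₀ α ∧ IsFree b i₀ β := by
        simp only [IsFree]; lia
      by_cases h₁ : IsFree b i₀ α <;> by_cases h₂ : IsFree b i₀ β <;>
        simp [indicator, hα, hβ, h₁, h₂, this]
    · simp [indicator, hβ]
  · simp [indicator, hα]

/-- The projection of the negative Borel subalgebra onto its subalgebra. -/
def borelProj : negBorel b →ₗ⁅K⁆ subBorel b i₀ where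
  toFun x := ⟨weightProj (IsFree b i₀) x, weightProj_isFree_mem b i₀ x.2⟩
  map_add' x y := Subtype.ext (map_add _ (x : L) (y : L))
  map_smul' c x := Subtype.ext (map_smul _ c (x : L))
  map_lie' {x y} := Subtype.ext (weightProj_isFree_lie b i₀ x.2 y.2)

theorem coe_borelProj (x : negBorel b) :
    (borelProj b i₀ x : L) = weightProj (IsFree b i₀) x := rfl

/-! ### The kernel of the projection -/

variable {b} {X : Weight K H L → L}

/-- A Lie ideal of the negative Borel subalgebra that contains the root space of `-i₀` contains
the root spaces of all negative roots that contain `i₀`. -/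
theorem rootSpace_le_of_contains (I : LieIdeal K (negBorel b))
    (hI : (rootSpace H (-(i₀ : H.root).1 : Weight K H L)).toSubmodule ≤
      I.toSubmodule.map (negBorel b).toSubmodule.subtype)
    (α : H.root) (hα : b.IsPos α) (hc : Contains b i₀ α) :
    (rootSpace H (-α.1 : Weight K H L)).toSubmodule ≤
      I.toSubmodule.map (negBorel b).toSubmodule.subtype := by
  have lie_mem {x y : L} (hx : x ∈ negBorel b)
      (hy : y ∈ I.toSubmodule.map (negBorel b).toSubmodule.subtype) :
      ⁅x, y⁆ ∈ I.toSubmodule.map (negBorel b).toSubmodule.subtype := by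
    obtain ⟨y, hy, rfl⟩ := hy
    exact ⟨⁅(⟨x, hx⟩ : negBorel b), y⁆, I.lie_mem hy, rfl⟩
  suffices b.IsPos α ∧ (Contains b i₀ α → (rootSpace H (-α.1 : Weight K H L)).toSubmodule ≤
      I.toSubmodule.map (negBorel b).toSubmodule.subtype) from this.2 hc
  -- Positive roots are reached by adding one simple root at a time. If `k = i + j` contains `i₀`,
  -- then either `i` contains it and the induction hypothesis applies, or `j = i₀` and `hI` applies.
  refine hα.induction_on_add (p := fun β => b.IsPos β ∧ (Contains b i₀ β →
    (rootSpace H (-β.1 : Weight K H L)).toSubmodule ≤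
      I.toSubmodule.map (negBorel b).toSubmodule.subtype)) (fun i hi => ⟨RootPairing.Base.isPos_of_mem_support hi, fun h => ?_⟩)
    fun i j k hk ⟨hi, hi'⟩ hj => ?_
  · have h' : b.toWeightBasis.repr ((rootSystem H).root ((⟨i, hi⟩ : b.support) : H.root)) i₀ ≠ 0 := h
    rw [b.toWeightBasis_repr_root, Finsupp.single_apply_ne_zero] at h'
    have hi₀ : (i₀ : H.root) = i := congrArg Subtype.val h'.1
    rw [← hi₀]
    exact hI
  · have hj' := RootPairing.Base.isPos_of_mem_support hj
    refine ⟨hi.add hj' hk, fun h => ?_⟩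
    have hsum : ((-k.1 : Weight K H L) : H → K) =
        (-j.1 : Weight K H L) + (-i.1 : Weight K H L) := by
      ext z
      have := LinearMap.congr_fun hk z
      change k.1 z = i.1 z + j.1 z at this
      simp only [Weight.coe_neg, Pi.add_apply, Pi.neg_apply, this]
      ring
    have hkne := (H.isNonZero_coe_root k).neg
    obtain ⟨x, hx, y, hy, hxy⟩ := exists_lie_ne_zero (H.isNonZero_coe_root j).neg hsum
    have hxyk : ⁅x, y⁆ ∈ rootSpace H (-k.1 : Weight K H L) := by
      rw [hsum]; exact lie_mem_genWeightSpace_of_mem_genWeightSpace hx hy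
    suffices hmem : ⁅x, y⁆ ∈ I.toSubmodule.map (negBorel b).toSubmodule.subtype by
      intro z hz
      obtain ⟨c, rfl⟩ := exists_smul_eq_of_mem_rootSpace hkne hxyk hxy hz
      exact Submodule.smul_mem _ c hmem
    by_cases hci : Contains b i₀ i
    · exact lie_mem (rootSpace_le_negBorel b j hj' hx) (hi' hci hy)
    · have hji : j = i₀ := by
        have h' : b.toWeightBasis.repr ((rootSystem H).root i) i₀ +
            b.toWeightBasis.repr ((rootSystem H).root ((⟨j, hj⟩ : b.support) : H.root)) i₀ ≠ 0 := by
          rw [← Finsupp.add_apply, ← map_add, ← hk]; exact h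
        rw [not_not.1 hci, zero_add, b.toWeightBasis_repr_root,
          Finsupp.single_apply_ne_zero] at h'
        exact (congrArg Subtype.val h'.1).symm
      rw [← lie_skew]
      refine Submodule.neg_mem _ (lie_mem (rootSpace_le_negBorel b i hi hy) (hI ?_))
      rw [← hji]; exact hx

/-- The kernel is the sum of the root spaces of the negative roots that contain `i₀`, and
`rootSpace_le_of_contains` puts each of them into the generated ideal. -/
theorem ker_borelProj (hX : IsCartanWeyl X) (y₀ : negBorel b)
    (hy₀ : (y₀ : L) = X (-(i₀ : H.root).1)) :
    (borelProj b i₀).ker = LieSubmodule.lieSpan K (negBorel b) {y₀} := by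
  have hne := (H.isNonZero_coe_root (i₀ : H.root)).neg
  refine le_antisymm (fun y hy => ?_) (LieSubmodule.lieSpan_le.2 (Set.singleton_subset_iff.2 ?_))
  · set I := LieSubmodule.lieSpan K (negBorel b) {y₀}
    have hI : (rootSpace H (-(i₀ : H.root).1 : Weight K H L)).toSubmodule ≤
        I.toSubmodule.map (negBorel b).toSubmodule.subtype := fun z hz => by
      obtain ⟨c, rfl⟩ := hX.exists_smul_eq hne hz
      exact Submodule.smul_mem _ c
        ⟨y₀, LieSubmodule.subset_lieSpan (Set.mem_singleton y₀), hy₀⟩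
    have h₁ : weightProj (IsFree b i₀) (y : L) = 0 := congrArg Subtype.val hy
    have h₂ := (mem_negBorel_iff b).1 y.2
    have h₃ : weightProj (fun α => ¬ IsFree b i₀ α ∧ IsNonpos b α) (y : L) = y := by
      rw [← weightProj_weightProj (fun α => ¬ IsFree b i₀ α), h₂]
      have : weightProj (fun α => ¬ IsFree b i₀ α) (y : L) =
          weightMul (fun α => 1 - indicator (IsFree b i₀) α) (y : L) := by
        rw [weightProj]
        congr 2
        ext α
        by_cases h : IsFree b i₀ α <;> simp [indicator, h]
      rw [this, weightMul_sub, weightMul_one]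
      exact (congrArg (fun z => (y : L) - z) h₁).trans (sub_zero _)
    have h₄ : (y : L) ∈ I.toSubmodule.map (negBorel b).toSubmodule.subtype := by
      rw [← h₃]
      refine weightProj_mem (fun α hα => ?_) _
      obtain ⟨hf, hα⟩ := hα
      have hα' : weightHeight b α ≤ 0 := hα
      have hlt : weightHeight b α < 0 := by
        refine lt_of_le_of_ne hα fun h0 => hf ?_
        have hz := (weightHeight_eq_zero_iff b).1 h0
        have := intCoeff_add b (α := α) (β := α) (γ := α) (by rw [hz.eq, add_zero]) i₀
        rw [IsFree]
        lia
      obtain ⟨β, hβ, -, rfl⟩ := exists_root_neg b hlt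
      refine rootSpace_le_of_contains i₀ I hI β hβ ?_
      rw [contains_iff]
      rw [IsFree, intCoeff_neg] at hf
      lia
    obtain ⟨z, hz, hzy⟩ := h₄
    rwa [← (Subtype.ext hzy : z = y)]
  · refine Subtype.ext ?_
    change weightProj (IsFree b i₀) (y₀ : L) = 0
    rw [hy₀]
    refine weightProj_of_not_mem ?_ (hX.mem _ hne)
    have h₁ := repr_eq_intCoeff b (i₀ : H.root).1 i₀
    have h₂ := b.toWeightBasis_repr_root i₀
    have h₃ : (1 : K) = intCoeff b (i₀ : H.root).1 i₀ := by
      rw [← h₁]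
      change _ = b.toWeightBasis.repr ((rootSystem H).root i₀) i₀
      rw [h₂, Finsupp.single_eq_same]
    have h₄ : (1 : ℤ) = intCoeff b (i₀ : H.root).1 i₀ := by exact_mod_cast h₃
    rw [IsFree, intCoeff_neg]
    lia

/-! ### The bialgebra structures -/

variable {B : (rootSystem H).InvariantForm} {κ : LinearMap.BilinForm K L}

/-- A component outside the Borel subalgebra would be detected by weights `α`, `β` of opposite sign,
where the factor of `star_of_mem` vanishes. -/
theorem weightProj_cobracket_of_isNonpos (hκ : IsAdapted B X κ) (hX : IsCartanWeyl X) {x : L}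
    (hx : x ∈ negBorel b) :
    TensorProduct.map (weightProj (IsNonpos b)) (weightProj (IsNonpos b)) (cobracket b B X x) =
      cobracket b B X x := by
  rw [mem_negBorel_iff] at hx
  rw [← hx]
  refine hκ.map_weightMul_cobracket hX (fun α β γ h => ?_) x
  by_cases hγ : IsNonpos b γ
  swap
  · simp [indicator, hγ]
  have hsum : weightHeight b (-γ) = weightHeight b α + weightHeight b β :=
    weightHeight_add b (by rw [Weight.coe_neg]; exact (eq_neg_of_add_eq_zero_left h).symm)
  rw [weightHeight_neg] at hsum
  have hγ' : weightHeight b γ ≤ 0 := hγ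
  by_cases hα : IsNonpos b (-α)
  · by_cases hβ : IsNonpos b (-β)
    · simp [indicator, hα, hβ, hγ]
    · rw [IsNonpos, weightHeight_neg] at hβ
      rw [rCoef_of_neg b (α := β) (by lia), rCoef_of_pos b (α := α) (by lia)]
      ring
  · rw [IsNonpos, weightHeight_neg] at hα
    rw [rCoef_of_neg b (α := α) (by lia), rCoef_of_pos b (α := β) (by lia)]
    ring

/-- If `α + β` has coefficient zero at `i₀` but `α` does not, then `α` and `β` have opposite signs
and the factor of `star_of_mem` vanishes. Unlike compatibility with the bracket, this holds on all
of `L`. -/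
theorem weightProj_cobracket_of_isFree (hκ : IsAdapted B X κ) (hX : IsCartanWeyl X) (x : L) :
    TensorProduct.map (weightProj (IsFree b i₀)) (weightProj (IsFree b i₀)) (cobracket b B X x) =
      cobracket b B X (weightProj (IsFree b i₀) x) := by
  conv_lhs => rw [← weightMul_one (H := H) x]
  refine hκ.map_weightMul_cobracket hX (fun α β γ h => ?_) x
  have hsum : intCoeff b (-γ) i₀ = intCoeff b α i₀ + intCoeff b β i₀ :=
    intCoeff_add b (by rw [Weight.coe_neg]; exact (eq_neg_of_add_eq_zero_left h).symm) i₀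
  rw [intCoeff_neg] at hsum
  have neg_iff (α : Weight K H L) : IsFree b i₀ (-α) ↔ IsFree b i₀ α := by
    rw [IsFree, IsFree, intCoeff_neg, neg_eq_zero]
  by_cases hα : IsFree b i₀ α
  · have : IsFree b i₀ γ ↔ IsFree b i₀ β := by simp only [IsFree] at *; lia
    by_cases hβ : IsFree b i₀ β <;> simp [indicator, neg_iff, hα, hβ, this]
  · by_cases hγ : IsFree b i₀ γ
    · rcases lt_or_gt_of_ne hα with h' | h'
      · rw [rCoef_of_neg b (weightHeight_neg_of_intCoeff_neg b h'),
          rCoef_of_pos b (α := β) (weightHeight_pos_of_intCoeff_pos b (i := i₀)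
            (by simp only [IsFree] at *; lia))]
        ring
      · rw [rCoef_of_pos b (weightHeight_pos_of_intCoeff_pos b h'),
          rCoef_of_neg b (α := β) (weightHeight_neg_of_intCoeff_neg b (i := i₀)
            (by simp only [IsFree] at *; lia))]
        ring
    · simp [indicator, neg_iff, hα, hγ]

theorem weightProj_cobracket_of_subBorel (hκ : IsAdapted B X κ) (hX : IsCartanWeyl X) {x : L}
    (hx : x ∈ subBorel b i₀) :
    TensorProduct.map (weightProj fun α => IsFree b i₀ α ∧ IsNonpos b α)
      (weightProj fun α => IsFree b i₀ α ∧ IsNonpos b α) (cobracket b B X x) =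
      cobracket b B X x := by
  have h : (weightProj fun α => IsFree b i₀ α ∧ IsNonpos b α) =
      weightProj (IsFree b i₀) ∘ₗ weightProj (IsNonpos b) :=
    LinearMap.ext fun y => (weightProj_weightProj _ _ y).symm
  rw [h, TensorProduct.map_comp, LinearMap.comp_apply,
    weightProj_cobracket_of_isNonpos hκ hX (subBorel_le b i₀ hx),
    weightProj_cobracket_of_isFree i₀ hκ hX, weightProj_isFree_of_mem b i₀ hx]

theorem isSubLieBialgebra_negBorel (hκ : IsAdapted B X κ) (hX : IsCartanWeyl X) :
    IsSubLieBialgebra (cobracket b B X) (negBorel b)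
      (restrictCobracket (cobracket b B X) (negBorel b) (projNegBorel b)) :=
  (hκ.isLieBialgebra hX).restrict fun _ hx => weightProj_cobracket_of_isNonpos hκ hX hx

theorem isSubLieBialgebra_subBorel (hκ : IsAdapted B X κ) (hX : IsCartanWeyl X) :
    IsSubLieBialgebra (cobracket b B X) (subBorel b i₀)
      (restrictCobracket (cobracket b B X) (subBorel b i₀) (projSubBorel b i₀)) :=
  (hκ.isLieBialgebra hX).restrict fun _ hx => weightProj_cobracket_of_subBorel i₀ hκ hX hx

theorem isSplitLieBialgebraProjection_borelProj (hκ : IsAdapted B X κ) (hX : IsCartanWeyl X) :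
    IsSplitLieBialgebraProjection
      (restrictCobracket (cobracket b B X) (negBorel b) (projNegBorel b))
      (restrictCobracket (cobracket b B X) (subBorel b i₀) (projSubBorel b i₀))
      (borelProj b i₀) (subBorelIncl b i₀) where
  isLieBialgebra_source := (isSubLieBialgebra_negBorel hκ hX).isLieBialgebra
  isLieBialgebra_target := (isSubLieBialgebra_subBorel i₀ hκ hX).isLieBialgebra
  isLieBialgebraMap_proj x := by
    have hinj : Function.Injective (subBorel b i₀).toSubmodule.subtype := Subtype.val_injective
    -- The identity is checked in `L ⊗ L`, where both restricted cobrackets become the cobracket of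
    -- `L`.
    refine map_injective hinj ?_
    have h₁ := (isSubLieBialgebra_negBorel hκ hX).isLieBialgebraMap x
    have h₂ := (isSubLieBialgebra_subBorel i₀ hκ hX).isLieBialgebraMap (borelProj b i₀ x)
    refine Eq.trans ?_ h₂.symm
    refine Eq.trans ?_ (weightProj_cobracket_of_isFree i₀ hκ hX (x : L))
    refine Eq.trans ?_ (congrArg _ h₁)
    rw [TensorProduct.map_map, TensorProduct.map_map]
    rfl
  isLieBialgebraMap_incl x := by
    have hinj : Function.Injective (negBorel b).toSubmodule.subtype := Subtype.val_injective
    refine map_injective hinj ?_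
    have h₁ := (isSubLieBialgebra_negBorel hκ hX).isLieBialgebraMap (subBorelIncl b i₀ x)
    have h₂ := (isSubLieBialgebra_subBorel i₀ hκ hX).isLieBialgebraMap x
    refine Eq.trans ?_ h₁.symm
    refine Eq.trans ?_ h₂
    rw [TensorProduct.map_map]
    rfl
  proj_incl ξ := Subtype.ext (weightProj_isFree_of_mem b i₀ ξ.2)

end Borel

end LieBialg

end

/-! ### Assembly of the proposition -/

theorem proposition4p5 {K L : Type*} [Field K] [CharZero K] [LieRing L] [LieAlgebra K L]
    [FiniteDimensional K L] [LieAlgebra.IsSimple K L]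
    (H : LieSubalgebra K L) [H.IsCartanSubalgebra] [LieModule.IsTriangularizable K H L]
    (b : (LieAlgebra.IsKilling.rootSystem H).Base)
    (B : (LieAlgebra.IsKilling.rootSystem H).InvariantForm)
    (X : LieModule.Weight K H L → L) (hX : LieBialg.IsCartanWeyl X)
    (i₀ : b.support) (h₀ : LieAlgebra.IsSimple K (LieBialg.deleted b i₀)) :
    LieBialg.IsLieBialgebra (LieBialg.cobracket b B X) ∧
    ∃ (δb : LieBialg.negBorel b →ₗ[K] LieBialg.negBorel b ⊗[K] LieBialg.negBorel b)
      (δf : LieBialg.subBorel b i₀ →ₗ[K] LieBialg.subBorel b i₀ ⊗[K] LieBialg.subBorel b i₀),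
      -- the negative Borel subalgebra and its subalgebra are sub-Lie bialgebras
      LieBialg.IsSubLieBialgebra (LieBialg.cobracket b B X) (LieBialg.negBorel b) δb ∧
      LieBialg.IsSubLieBialgebra (LieBialg.cobracket b B X) (LieBialg.subBorel b i₀) δf ∧
      ∃ π : LieBialg.negBorel b →ₗ⁅K⁆ LieBialg.subBorel b i₀,
        -- the values of the projection on a basis
        (∀ y : LieBialg.negBorel b, (y : L) ∈ H → (π y : L) = y) ∧
        (∀ (α : H.root) (y : LieBialg.negBorel b), b.IsPos α → (y : L) = X (-α.1) →
          (LieBialg.Contains b i₀ α → π y = 0) ∧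
          (¬ LieBialg.Contains b i₀ α → (π y : L) = y)) ∧
        LieBialg.IsSplitLieBialgebraProjection δb δf π (LieBialg.subBorelIncl b i₀) ∧
        -- the kernel is the Lie ideal that the root vector `X (-α_{i₀})` generates
        (∃ y₀ : LieBialg.negBorel b, (y₀ : L) = X (-(i₀ : H.root).1) ∧
          π.ker = LieSubmodule.lieSpan K (LieBialg.negBorel b) {y₀}) ∧
        -- the kernel is a braided-Lie bialgebra: the action is the adjoint action, the coaction
        -- is `(π ⊗ id) ∘ δ` and the cobracket is `(id - i ∘ π) ⊗ (id - i ∘ π) ∘ δ`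
        ∃ (β : π.ker →ₗ[K] LieBialg.subBorel b i₀ ⊗[K] π.ker)
          (δk : π.ker →ₗ[K] π.ker ⊗[K] π.ker),
          (∀ x : π.ker,
            TensorProduct.map LinearMap.id π.ker.toSubmodule.subtype (β x) =
              TensorProduct.map π.toLinearMap LinearMap.id (δb x)) ∧
          (∀ x : π.ker,
            TensorProduct.map π.ker.toSubmodule.subtype π.ker.toSubmodule.subtype (δk x) =
              TensorProduct.map
                (LinearMap.id - (LieBialg.subBorelIncl b i₀).toLinearMap ∘ₗ π.toLinearMap)
                (LinearMap.id - (LieBialg.subBorelIncl b i₀).toLinearMap ∘ₗ π.toLinearMap)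
                (δb x)) ∧
          LieBialg.IsBraidedLieBialgebra δf
            ((LieModule.toEnd K (LieBialg.negBorel b) π.ker :
                LieBialg.negBorel b →ₗ[K] Module.End K π.ker) ∘ₗ
              (LieBialg.subBorelIncl b i₀).toLinearMap)
            β δk := by
  obtain ⟨κ, hκ⟩ := LieBialg.exists_isAdapted B hX
  have hs := LieBialg.isSplitLieBialgebraProjection_borelProj (b := b) i₀ hκ hX
  have hi₀ := RootPairing.Base.isPos_of_mem_support i₀.2
  have hmem : X (-(i₀ : H.root).1) ∈ LieBialg.negBorel b :=
    LieBialg.rootSpace_le_negBorel b i₀ hi₀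
      (hX.mem _ (H.isNonZero_coe_root (i₀ : H.root)).neg)
  refine ⟨hκ.isLieBialgebra hX, _, _, LieBialg.isSubLieBialgebra_negBorel hκ hX,
    LieBialg.isSubLieBialgebra_subBorel i₀ hκ hX, LieBialg.borelProj b i₀, fun y hy => ?_,
    fun α y hα hy => ⟨fun hc => ?_, fun hc => ?_⟩, hs,
    ⟨⟨X (-(i₀ : H.root).1), hmem⟩, rfl, LieBialg.ker_borelProj i₀ hX _ rfl⟩,
    LieBialg.kerCoact _ hs.proj_incl, LieBialg.kerCobracket _ hs.proj_incl,
    hs.map_subtype_kerCoact, LieBialg.map_subtype_kerCobracket hs.proj_incl,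
    hs.isBraidedLieBialgebra⟩
  · exact LieBialg.weightProj_isFree_of_mem b i₀ (LieSubalgebra.subset_lieSpan (Or.inl hy))
  · refine Subtype.ext ?_
    rw [LieBialg.coe_borelProj, hy]
    refine LieBialg.weightProj_of_not_mem ?_ (hX.mem _ (H.isNonZero_coe_root α).neg)
    rw [LieBialg.IsFree, LieBialg.intCoeff_neg, neg_eq_zero]
    exact (LieBialg.contains_iff b i₀ α).1 hc
  · rw [LieBialg.coe_borelProj, hy]
    refine LieBialg.weightProj_of_mem ?_ (hX.mem _ (H.isNonZero_coe_root α).neg)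
    rw [LieBialg.IsFree, LieBialg.intCoeff_neg, neg_eq_zero]
    exact not_not.1 fun h => hc ((LieBialg.contains_iff b i₀ α).2 h)
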